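/- All Hilbert spaces are complex and separable, possibly infinite-dimensional; $\otimes$ is the Hilbert space tensor product, $\mathcal{T}(\mathcal{H})$ is the space of trace-class operators with the trace norm, and $\mathcal{D}(\mathcal{H})\subset\mathcal{T}(\mathcal{H})$ is the set of density operators (positive semidefinite, trace $1$). For $\rho\in\mathcal{D}(\mathcal{H})$ let $S(\rho)=-\operatorname{Tr}[\rho\log_2\rho]\in[0,\infty]$ be the quantum entropy. A quantum channel is a completely positive trace-preserving linear map between spaces of trace-class operators; an instrument is a countable family of completely positive maps $(\mathcal{E}_x)_x$ whose sum is a quantum channel. A channel $\mathcal{E}:\mathcal{T}(\mathcal{H}_A\otimes\mathcal{H}_B)\to\mathcal{T}(\mathcal{H}_{A'}\otimes\mathcal{H}_{B'})$ is countably separable if there are bounded operators $L_k:\mathcal{H}_A\to\mathcal{H}_{A'}$, $M_k:\mathcal{H}_B\to\mathcal{H}_{B'}$ ($k=1,2,\dots$) with $\mathcal{E}(T)=\sum_{k=1}^\infty (L_k\otimes M_k)\,T\,(L_k\otimes M_k)^\dagger$ for all $T$. An instrument $(\mathcal{E}_x)_x$ is countably separable if the channel $T\mapsto\sum_x \mathcal{E}_x(T)\otimes|x\rangle\langle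 x|_X$ is countably separable with respect to the output bipartition $A'X:B'$, where $X$ is a classical register with orthonormal basis $(|x\rangle)_x$. For a unit vector $|\psi\rangle\in\mathcal{H}_A\otimes\mathcal{H}_B$ write $\psi=|\psi\rangle\langle\psi|$ and $\psi^A=\operatorname{Tr}_B\psi$. The entanglement of formation of $\rho\in\mathcal{D}(\mathcal{H}_A\otimes\mathcal{H}_B)$ is $$E_f(\rho)=\inf_{\rho=\sum_x p(x)\psi_x}\ \sum_x p(x)\,S(\psi_x^A)\in[0,\infty],$$ where the infimum is over all countable convex decompositions of $\rho$ into pure states. **Proposition.** Let $\mathcal{H}_A,\mathcal{H}_B,\mathcal{H}_{A'},\mathcal{H}_{B'}$ be separable Hilbert spaces. (1) Let $|\psi\rangle\in\mathcal{H}_A\otimes\mathcal{H}_B$ be a unit vector, let $(\mathcal{E}_x)_x$ be a countably separable instrument from $AB$ to $A'B'$, and suppose that it transforms $\psi$ into a countable ensemble of pure states $\{p(x),|\phi_x\rangle\}_x$, i.e. $p$ is a probability distribution, the $|\phi_x\rangle\in\mathcal{H}_{A'}\otimes\mathcal{H}_{B'}$ are unit vectors, and $\mathcal{E}_x(\psi)=p(x)\,\phi_x$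 for all $x$. Then $$S(\psi^A)\ \ge\ \sum_x p(x)\,S(\phi_x^{A'}).$$ (2) The entanglement of formation is monotonic under countably separable channels: for every $\rho\in\mathcal{D}(\mathcal{H}_A\otimes\mathcal{H}_B)$ and every countably separable channel $\mathcal{E}$ from $AB$ to $A'B'$, $$E_f(\rho)\ \ge\ E_f(\mathcal{E}(\rho)).$$ Both inequalities are between elements of $[0,\infty]$, with $0\cdot\infty=0$. -/

import Mathlib

open scoped ENNReal NNReal InnerProductSpace TensorProduct ComplexOrder lp

noncomputable section

namespace EntForm

/-! ### Trace, absolute value, trace norm -/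

section Trace

variable (H : Type*) [NormedAddCommGroup H] [InnerProductSpace ℂ H] [CompleteSpace H]

/-- The index set of a fixed orthonormal (Hilbert) basis of `H`. -/
def BasisIndex : Set H := (exists_hilbertBasis ℂ H).choose

/-- A fixed orthonormal (Hilbert) basis of `H`, used to write down traces. -/
def onb : HilbertBasis (BasisIndex H) ℂ H := (exists_hilbertBasis ℂ H).choose_spec.choose

variable {H}

/-- The trace `∑ₙ ⟨n, A n⟩ ∈ [0, ∞]` of a positive semidefinite bounded operator `A`. -/
def posTrace (A : H →L[ℂ] H) : ℝ≥0∞ :=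
  ∑' i, ENNReal.ofReal (⟪onb H i, A (onb H i)⟫_ℂ).re

/-- `‖T‖₁ = Tr |T| ∈ [0, ∞]`, where `|T| = √(T† T)`. -/
def traceNorm (T : H →L[ℂ] H) : ℝ≥0∞ := posTrace (CFC.abs T)

end Trace

section TraceLemmas

variable {H : Type*} [NormedAddCommGroup H] [InnerProductSpace ℂ H] [CompleteSpace H]
variable {G : Type*} [NormedAddCommGroup G] [InnerProductSpace ℂ G] [CompleteSpace G]

theorem abs_norm_apply (T : H →L[ℂ] H) (x : H) : ‖CFC.abs T x‖ = ‖T x‖ := by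
  have hsa : ContinuousLinearMap.adjoint (CFC.abs T) = CFC.abs T := by
    have := (CFC.abs_nonneg T).isSelfAdjoint
    rwa [ContinuousLinearMap.isSelfAdjoint_iff'] at this
  have h : ⟪CFC.abs T x, CFC.abs T x⟫_ℂ = ⟪T x, T x⟫_ℂ := by
    rw [← ContinuousLinearMap.adjoint_inner_right, hsa]
    have h2 : CFC.abs T (CFC.abs T x) = (CFC.abs T * CFC.abs T) x := rfl
    rw [h2, CFC.abs_mul_abs]
    change ⟪x, ContinuousLinearMap.adjoint T (T x)⟫_ℂ = _
    rw [ContinuousLinearMap.adjoint_inner_right]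
  rw [inner_self_eq_norm_sq_to_K, inner_self_eq_norm_sq_to_K] at h
  have h3 : ‖CFC.abs T x‖ ^ 2 = ‖T x‖ ^ 2 := by exact_mod_cast h
  exact (pow_left_inj₀ (norm_nonneg _) (norm_nonneg _) two_ne_zero).1 h3

theorem exists_polar (T : H →L[ℂ] H) : ∃ U : H →L[ℂ] H, ‖U‖ ≤ 1 ∧
    (∀ x, U (CFC.abs T x) = T x) ∧ ∀ x y, ⟪U x, T y⟫_ℂ = ⟪x, CFC.abs T y⟫_ℂ := by
  set P := CFC.abs T with hP
  let K : Submodule ℂ H := (LinearMap.range P.toLinearMap).topologicalClosure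
  have hK : ∀ x, P x ∈ K := fun x => Submodule.le_topologicalClosure _ ⟨x, rfl⟩
  have : CompleteSpace K :=
    (Submodule.isClosed_topologicalClosure _).completeSpace_coe
  let e : H →ₗ[ℂ] K := P.toLinearMap.codRestrict K hK
  have he : DenseRange e := by
    intro y
    rw [Metric.mem_closure_iff]
    intro ε hε
    have hy : (y : H) ∈ closure (LinearMap.range P.toLinearMap : Set H) := y.2
    obtain ⟨z, ⟨x, rfl⟩, hz⟩ := Metric.mem_closure_iff.1 hy ε hε
    exact ⟨e x, ⟨x, rfl⟩, hz⟩
  have hn : ∀ x, ‖T.toLinearMap x‖ ≤ 1 * ‖e x‖ := fun x => by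
    rw [one_mul]
    exact (abs_norm_apply T x).symm.le
  let V : K →L[ℂ] H := T.toLinearMap.extendOfNorm e
  have hV : ∀ x, V (e x) = T x := fun x =>
    LinearMap.extendOfNorm_eq (f := T.toLinearMap) (e := e) he ⟨1, hn⟩ x
  have hVn : ∀ y, ‖V y‖ ≤ 1 * ‖y‖ := fun y =>
    LinearMap.norm_extendOfNorm_apply_le (f := T.toLinearMap) (e := e) he 1 hn y
  let U : H →L[ℂ] H := V ∘L K.orthogonalProjectionOnto
  refine ⟨U, ?_, ?_, ?_⟩
  · refine ContinuousLinearMap.opNorm_le_bound _ zero_le_one fun x => ?_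
    refine (hVn _).trans ?_
    rw [one_mul, one_mul]
    exact K.norm_orthogonalProjectionOnto_apply_le x
  · intro x
    change V (K.orthogonalProjectionOnto (P x)) = T x
    rw [← hV x]
    congr 1
    exact K.orthogonalProjectionOnto_mem_subspace_eq_self (e x)
  · intro x y
    have h1 : ∀ k : K, ⟪V k, T y⟫_ℂ = ⟪(k : H), P y⟫_ℂ := by
      intro k
      refine he.induction_on (p := fun k : K => ⟪V k, T y⟫_ℂ = ⟪(k : H), P y⟫_ℂ) k ?_ ?_
      · exact isClosed_eq (by fun_prop) (by fun_prop)
      · intro x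
        rw [hV]
        change _ = ⟪P x, P y⟫_ℂ
        have hsa : ContinuousLinearMap.adjoint P = P := by
          have := (CFC.abs_nonneg T).isSelfAdjoint
          rwa [ContinuousLinearMap.isSelfAdjoint_iff'] at this
        rw [← ContinuousLinearMap.adjoint_inner_right P, hsa]
        have h2 : P (P y) = (CFC.abs T * CFC.abs T) y := rfl
        rw [h2, CFC.abs_mul_abs]
        change _ = ⟪x, ContinuousLinearMap.adjoint T (T y)⟫_ℂ
        rw [ContinuousLinearMap.adjoint_inner_right]
    change ⟪V (K.orthogonalProjectionOnto x), T y⟫_ℂ = _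
    rw [h1]
    exact K.inner_orthogonalProjectionOnto_eq_of_mem_right ⟨P y, hK y⟩ x

/-- Parseval's identity. -/
theorem tsum_enorm_inner_sq {ι : Type*} (b : HilbertBasis ι ℂ H) (x : H) :
    ∑' i, ‖⟪b i, x⟫_ℂ‖ₑ ^ 2 = ‖x‖ₑ ^ 2 := by
  have h := b.hasSum_inner_mul_inner x x
  have h1 : ∀ i, ⟪x, b i⟫_ℂ * ⟪b i, x⟫_ℂ = ((‖⟪b i, x⟫_ℂ‖ ^ 2 : ℝ) : ℂ) := fun i => by
    rw [← inner_conj_symm, ← Complex.normSq_eq_conj_mul_self, Complex.normSq_eq_norm_sq]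
  simp only [h1] at h
  rw [inner_self_eq_norm_sq_to_K] at h
  have h2 : HasSum (fun i => ‖⟪b i, x⟫_ℂ‖ ^ 2) (‖x‖ ^ 2) := by
    refine Complex.hasSum_ofReal.1 ?_
    rw [Complex.ofReal_pow]
    exact h
  have h3 := ENNReal.ofReal_tsum_of_nonneg (fun i => by positivity) h2.summable
  rw [h2.tsum_eq] at h3
  simp only [← ofReal_norm, ← ENNReal.ofReal_pow (norm_nonneg _)]
  exact h3.symm

theorem tsum_enorm_sq_adjoint {ι κ : Type*} (c : HilbertBasis ι ℂ G) (b : HilbertBasis κ ℂ H)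
    (W : G →L[ℂ] H) :
    ∑' i, ‖W (c i)‖ₑ ^ 2 = ∑' j, ‖ContinuousLinearMap.adjoint W (b j)‖ₑ ^ 2 := by
  simp only [← tsum_enorm_inner_sq b (W _),
    ← tsum_enorm_inner_sq c (ContinuousLinearMap.adjoint W _)]
  rw [ENNReal.tsum_comm]
  refine tsum_congr fun j => tsum_congr fun i => ?_
  rw [ContinuousLinearMap.adjoint_inner_right, ← inner_conj_symm]
  simp only [← ofReal_norm, RCLike.norm_conj]

theorem exists_sqrt {A : H →L[ℂ] H} (hA : 0 ≤ A) : ∃ R : H →L[ℂ] H,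
    ContinuousLinearMap.adjoint R = R ∧ (∀ x, R (R x) = A x) ∧
      ∀ x, ENNReal.ofReal (⟪x, A x⟫_ℂ).re = ‖R x‖ₑ ^ 2 := by
  have hsa : ContinuousLinearMap.adjoint (CFC.sqrt A) = CFC.sqrt A := by
    have := (CFC.sqrt_nonneg A).isSelfAdjoint
    rwa [ContinuousLinearMap.isSelfAdjoint_iff'] at this
  have hm : ∀ x, CFC.sqrt A (CFC.sqrt A x) = A x := fun x => by
    change (CFC.sqrt A * CFC.sqrt A) x = A x
    rw [CFC.sqrt_mul_sqrt_self A hA]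
  refine ⟨CFC.sqrt A, hsa, hm, fun x => ?_⟩
  rw [← hm x, ← ContinuousLinearMap.adjoint_inner_left, hsa, inner_self_eq_norm_sq_to_K,
    ← ofReal_norm, ← ENNReal.ofReal_pow (norm_nonneg _)]
  congr 1
  norm_cast

/-- The trace of a positive operator can be computed in every orthonormal basis. -/
theorem posTrace_eq {ι : Type*} (b : HilbertBasis ι ℂ H) {A : H →L[ℂ] H} (hA : 0 ≤ A) :
    posTrace A = ∑' i, ENNReal.ofReal (⟪b i, A (b i)⟫_ℂ).re := by
  obtain ⟨R, hR, -, h⟩ := exists_sqrt hA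
  simp only [posTrace, h]
  rw [tsum_enorm_sq_adjoint (onb H) b R, hR]

theorem tsum_mul_le {ι : Type*} (f g : ι → ℝ≥0∞) (a b t : ℝ≥0∞)
    (hf : ∑' i, f i ^ 2 ≤ a ^ 2 * t) (hg : ∑' i, g i ^ 2 ≤ b ^ 2 * t) :
    ∑' i, f i * g i ≤ a * b * t := by
  rw [ENNReal.tsum_eq_iSup_sum]
  refine iSup_le fun s => ?_
  have h := ENNReal.inner_le_Lp_mul_Lq s f g (p := 2) (q := 2)
    (Real.holderConjugate_iff.2 ⟨by norm_num, by norm_num⟩)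
  refine h.trans ?_
  have key : ∀ (f : ι → ℝ≥0∞) (a : ℝ≥0∞), ∑' i, f i ^ 2 ≤ a ^ 2 * t →
      (∑ i ∈ s, f i ^ (2 : ℝ)) ^ (1 / 2 : ℝ) ≤ a * t ^ (1 / 2 : ℝ) := by
    intro f a hf
    have h1 : ∑ i ∈ s, f i ^ (2 : ℝ) ≤ a ^ (2 : ℝ) * t := by
      simp only [ENNReal.rpow_two]
      exact (ENNReal.sum_le_tsum s).trans hf
    refine (ENNReal.rpow_le_rpow h1 (by norm_num)).trans ?_
    rw [ENNReal.mul_rpow_of_nonneg _ _ (by norm_num), ← ENNReal.rpow_mul]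
    norm_num
  refine (mul_le_mul' (key f a hf) (key g b hg)).trans ?_
  have : t ^ (1 / 2 : ℝ) * t ^ (1 / 2 : ℝ) = t := by
    rw [← ENNReal.rpow_add_of_nonneg _ _ (by norm_num) (by norm_num)]
    norm_num
  calc a * t ^ (1 / 2 : ℝ) * (b * t ^ (1 / 2 : ℝ))
      = a * b * (t ^ (1 / 2 : ℝ) * t ^ (1 / 2 : ℝ)) := by ring
    _ ≤ a * b * t := by rw [this]

theorem enorm_adjoint (X : G →L[ℂ] H) : ‖ContinuousLinearMap.adjoint X‖ₑ = ‖X‖ₑ := by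
  simp only [← ofReal_norm, LinearIsometryEquiv.norm_map]

theorem tsum_inner_le {ι : Type*} (c : HilbertBasis ι ℂ G) (S : H →L[ℂ] H) (X Y : G →L[ℂ] H) :
    ∑' i, ‖⟪X (c i), S (Y (c i))⟫_ℂ‖ₑ ≤ ‖X‖ₑ * ‖Y‖ₑ * traceNorm S := by
  obtain ⟨V, hV, hVS, -⟩ := exists_polar S
  obtain ⟨R, hR, hRR, hRt⟩ := exists_sqrt (CFC.abs_nonneg S)
  have ht : traceNorm S = ∑' j, ‖R (onb H j)‖ₑ ^ 2 := by
    simp only [traceNorm, posTrace, hRt]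
  have hVe : ‖V‖ₑ ≤ 1 := by
    rw [← ofReal_norm]
    exact ENNReal.ofReal_le_one.2 hV
  have hW : ∀ (Z : H →L[ℂ] H) (X : G →L[ℂ] H), ‖Z‖ₑ ≤ 1 →
      ∑' i, ‖(R ∘L Z ∘L X) (c i)‖ₑ ^ 2 ≤ ‖X‖ₑ ^ 2 * traceNorm S := by
    intro Z X hZ
    rw [tsum_enorm_sq_adjoint c (onb H), ht, ← ENNReal.tsum_mul_left]
    refine ENNReal.tsum_le_tsum fun j => ?_
    rw [← mul_pow]
    refine pow_le_pow_left' ?_ 2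
    rw [ContinuousLinearMap.adjoint_comp, ContinuousLinearMap.adjoint_comp, hR]
    refine ((ContinuousLinearMap.adjoint X).le_opENorm _).trans ?_
    rw [enorm_adjoint]
    refine mul_le_mul_right ?_ _
    refine ((ContinuousLinearMap.adjoint Z).le_opENorm _).trans ?_
    rw [enorm_adjoint]
    exact (mul_le_mul_left hZ _).trans (one_mul _).le
  refine le_trans (ENNReal.tsum_le_tsum fun i => ?_)
    (tsum_mul_le (fun i => ‖(R ∘L ContinuousLinearMap.adjoint V ∘L X) (c i)‖ₑ)
      (fun i => ‖(R ∘L ContinuousLinearMap.id ℂ H ∘L Y) (c i)‖ₑ) _ _ _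
      (hW _ X (by rwa [enorm_adjoint])) (hW _ Y ?_))
  · rw [← hVS, ← hRR, ← ContinuousLinearMap.adjoint_inner_left,
      ← ContinuousLinearMap.adjoint_inner_left, hR]
    change ‖⟪R (ContinuousLinearMap.adjoint V (X (c i))), R (Y (c i))⟫_ℂ‖ₑ ≤
      ‖R (ContinuousLinearMap.adjoint V (X (c i)))‖ₑ * ‖R (Y (c i))‖ₑ
    simp only [← ofReal_norm]
    rw [← ENNReal.ofReal_mul (norm_nonneg _)]
    exact ENNReal.ofReal_le_ofReal (norm_inner_le_norm _ _)
  · rw [← ofReal_norm]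
    exact ENNReal.ofReal_le_one.2 ContinuousLinearMap.norm_id_le

theorem traceNorm_le_tsum (Z : H →L[ℂ] H) : ∃ U : H →L[ℂ] H, ‖U‖ₑ ≤ 1 ∧
    traceNorm Z ≤ ∑' i, ‖⟪U (onb H i), Z (onb H i)⟫_ℂ‖ₑ := by
  obtain ⟨U, hU, -, hUZ⟩ := exists_polar Z
  refine ⟨U, ?_, ENNReal.tsum_le_tsum fun i => ?_⟩
  · rw [← ofReal_norm]
    exact ENNReal.ofReal_le_one.2 hU
  · rw [hUZ, ← ofReal_norm]
    exact ENNReal.ofReal_le_ofReal (Complex.re_le_norm _)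

theorem traceNorm_add_le (S T : H →L[ℂ] H) :
    traceNorm (S + T) ≤ traceNorm S + traceNorm T := by
  obtain ⟨U, hU, h⟩ := traceNorm_le_tsum (S + T)
  have h1 : ∀ S : H →L[ℂ] H, ∑' i, ‖⟪U (onb H i), S (onb H i)⟫_ℂ‖ₑ ≤ traceNorm S := by
    intro S
    refine (tsum_inner_le (onb H) S U (ContinuousLinearMap.id ℂ H)).trans ?_
    refine (mul_le_mul_left (mul_le_one' hU ?_) _).trans (one_mul _).le
    rw [← ofReal_norm]
    exact ENNReal.ofReal_le_one.2 ContinuousLinearMap.norm_id_le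
  refine h.trans (le_trans ?_ (add_le_add (h1 S) (h1 T)))
  rw [← ENNReal.tsum_add]
  refine ENNReal.tsum_le_tsum fun i => ?_
  rw [add_apply, inner_add_right]
  exact enorm_add_le _ _

theorem traceNorm_sandwich_le (K L : H →L[ℂ] G) (T : H →L[ℂ] H) :
    traceNorm (K ∘L T ∘L ContinuousLinearMap.adjoint L) ≤ ‖K‖ₑ * ‖L‖ₑ * traceNorm T := by
  obtain ⟨U, hU, h⟩ := traceNorm_le_tsum (K ∘L T ∘L ContinuousLinearMap.adjoint L)
  refine h.trans ?_
  have h2 := tsum_inner_le (onb G) T (ContinuousLinearMap.adjoint K ∘L U)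
    (ContinuousLinearMap.adjoint L)
  have h3 : ‖ContinuousLinearMap.adjoint K ∘L U‖ₑ ≤ ‖K‖ₑ := by
    have h4 : ‖ContinuousLinearMap.adjoint K ∘L U‖ₑ ≤
        ‖ContinuousLinearMap.adjoint K‖ₑ * ‖U‖ₑ := by
      simp only [← ofReal_norm]
      rw [← ENNReal.ofReal_mul (norm_nonneg _)]
      exact ENNReal.ofReal_le_ofReal (ContinuousLinearMap.opNorm_comp_le _ _)
    rw [enorm_adjoint] at h4
    exact h4.trans ((mul_le_mul_right hU _).trans (mul_one _).le)
  rw [enorm_adjoint] at h2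
  refine le_trans (ENNReal.tsum_le_tsum fun i => ?_)
    (h2.trans (mul_le_mul_left (mul_le_mul_left h3 _) _))
  simp only [ContinuousLinearMap.comp_apply, ContinuousLinearMap.adjoint_inner_left]
  exact le_rfl

theorem traceNorm_zero : traceNorm (0 : H →L[ℂ] H) = 0 := by
  simp [traceNorm, posTrace]

theorem traceNorm_smul (a : ℂ) (T : H →L[ℂ] H) : traceNorm (a • T) = ‖a‖ₑ * traceNorm T := by
  simp only [traceNorm, posTrace, CFC.abs_smul]
  rw [← ENNReal.tsum_mul_left]
  refine tsum_congr fun i => ?_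
  rw [← ofReal_norm, ← ENNReal.ofReal_mul (norm_nonneg _)]
  congr 1
  rw [smul_apply, inner_smul_right_eq_smul]
  simp

theorem eq_zero_of_traceNorm {T : H →L[ℂ] H} (h : traceNorm T = 0) : T = 0 := by
  obtain ⟨R, hR, hRR, hRt⟩ := exists_sqrt (CFC.abs_nonneg T)
  have h1 : ∀ i, R (onb H i) = 0 := by
    simp only [traceNorm, posTrace, hRt, ENNReal.tsum_eq_zero] at h
    intro i
    simpa using h i
  have h2 : R = 0 := by
    ext x
    have h3 : R x = 0 := by
      have h4 : ∀ y, ⟪R x, y⟫_ℂ = 0 := by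
        intro y
        rw [← ContinuousLinearMap.adjoint_inner_right, hR]
        have h5 := tsum_enorm_inner_sq (onb H) (R y)
        have h6 : ∀ i, ⟪onb H i, R y⟫_ℂ = 0 := fun i => by
          rw [← ContinuousLinearMap.adjoint_inner_left, hR, h1, inner_zero_left]
        simp only [h6] at h5
        have h7 : R y = 0 := by simpa using h5.symm
        rw [h7, inner_zero_right]
      exact inner_self_eq_zero.1 (h4 _)
    simpa using h3
  have h3 : CFC.abs T = 0 := by
    ext x
    rw [← hRR, h2]
    simp
  exact CFC.abs_eq_zero_iff.1 h3

theorem traceNorm_of_nonneg {T : H →L[ℂ] H} (h : 0 ≤ T) : traceNorm T = posTrace T := by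
  rw [traceNorm, CFC.abs_of_nonneg T h]

theorem traceNorm_rankOne (ψ : H) :
    traceNorm (InnerProductSpace.rankOne ℂ ψ ψ) = ‖ψ‖ₑ ^ 2 := by
  rw [traceNorm_of_nonneg ((ContinuousLinearMap.nonneg_iff_isPositive _).2
    (InnerProductSpace.isPositive_rankOne_self ψ)), ← tsum_enorm_inner_sq (onb H) ψ, posTrace]
  refine tsum_congr fun i => ?_
  rw [InnerProductSpace.rankOne_apply, inner_smul_right, ← inner_conj_symm,
    ← Complex.normSq_eq_conj_mul_self, Complex.normSq_eq_norm_sq, ← ofReal_norm,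
    ← ENNReal.ofReal_pow (norm_nonneg _), Complex.ofReal_re]

end TraceLemmas

/-! ### The Banach space of trace-class operators -/

section TraceClass

variable (H : Type*) [NormedAddCommGroup H] [InnerProductSpace ℂ H] [CompleteSpace H]

/-- The trace-class operators, `‖T‖₁ = Tr |T| < ∞`, as a subspace of the bounded operators. -/
def traceClassSubmodule : Submodule ℂ (H →L[ℂ] H) where
  carrier := {T | traceNorm T < ∞}
  zero_mem' := by simp [traceNorm_zero]
  add_mem' := fun {S T} hS hT =>
    (traceNorm_add_le S T).trans_lt (ENNReal.add_lt_top.2 ⟨hS, hT⟩)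
  smul_mem' := fun a T hT => by
    change traceNorm (a • T) < ∞
    rw [traceNorm_smul]
    exact ENNReal.mul_lt_top enorm_lt_top hT

/-- The space `𝒯(H)` of trace-class operators; it carries the trace norm, not the operator norm. -/
def TraceClass : Type _ := traceClassSubmodule H

instance : AddCommGroup (TraceClass H) :=
  inferInstanceAs (AddCommGroup (traceClassSubmodule H))

instance : Module ℂ (TraceClass H) :=
  inferInstanceAs (Module ℂ (traceClassSubmodule H))

variable {H}

namespace TraceClass

/-- The inclusion of `𝒯(H)` into the bounded operators. -/
def toOp : TraceClass H →ₗ[ℂ] (H →L[ℂ] H) := (traceClassSubmodule H).subtype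

/-- A bounded operator of finite trace norm, as an element of `𝒯(H)`. -/
def mk (T : H →L[ℂ] H) (hT : traceNorm T < ∞) : TraceClass H := ⟨T, hT⟩

theorem toOp_injective : Function.Injective (toOp : TraceClass H → (H →L[ℂ] H)) :=
  Subtype.val_injective

theorem traceNorm_lt_top (T : TraceClass H) : traceNorm T.toOp < ∞ := T.2

instance : Norm (TraceClass H) := ⟨fun T => (traceNorm T.toOp).toReal⟩

/-- The trace norm makes `𝒯(H)` a normed space. -/
instance : NormedAddCommGroup (TraceClass H) :=
  AddGroupNorm.toNormedAddCommGroup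
    { toFun := fun T => ‖T‖
      map_zero' := by
        change (traceNorm (toOp (0 : TraceClass H))).toReal = 0
        rw [map_zero, traceNorm_zero, ENNReal.toReal_zero]
      add_le' := fun S T => by
        change (traceNorm (toOp (S + T))).toReal ≤ _
        rw [map_add]
        refine (ENNReal.toReal_mono ?_ (traceNorm_add_le _ _)).trans ENNReal.toReal_add_le
        exact (ENNReal.add_lt_top.2 ⟨S.traceNorm_lt_top, T.traceNorm_lt_top⟩).ne
      neg' := fun T => by
        change (traceNorm (toOp (-T))).toReal = (traceNorm (toOp T)).toReal
        rw [map_neg, traceNorm, CFC.abs_neg, ← traceNorm]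
      eq_zero_of_map_eq_zero' := fun T hT => by
        have h : traceNorm T.toOp = 0 :=
          ((ENNReal.toReal_eq_zero_iff _).1 hT).resolve_right T.traceNorm_lt_top.ne
        exact toOp_injective (by rw [eq_zero_of_traceNorm h, map_zero]) }

theorem norm_def (T : TraceClass H) : ‖T‖ = (traceNorm T.toOp).toReal := rfl

instance : NormedSpace ℂ (TraceClass H) where
  norm_smul_le a T := by
    rw [norm_def, norm_def, map_smul, traceNorm_smul, ENNReal.toReal_mul, toReal_enorm]

/-- The trace `Tr T = ∑ₙ ⟨n, T n⟩` of a trace-class operator. -/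
def trace (T : TraceClass H) : ℂ := ∑' i, ⟪onb H i, T.toOp (onb H i)⟫_ℂ

variable {G : Type*} [NormedAddCommGroup G] [InnerProductSpace ℂ G] [CompleteSpace G]

/-- The map `T ↦ K T K†` on trace-class operators, for a bounded operator `K`. -/
def conj (K : H →L[ℂ] G) : TraceClass H →ₗ[ℂ] TraceClass G where
  toFun T := mk (K ∘L T.toOp ∘L ContinuousLinearMap.adjoint K)
    ((traceNorm_sandwich_le K K T.toOp).trans_lt
      (ENNReal.mul_lt_top (ENNReal.mul_lt_top enorm_lt_top enorm_lt_top) T.traceNorm_lt_top))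
  map_add' S T := toOp_injective <| by
    ext x
    exact K.map_add (S.toOp _) (T.toOp _)
  map_smul' a T := toOp_injective <| by
    ext x
    exact K.map_smul a (T.toOp _)

/-- `T ∈ 𝒟(H)`: density operators, the positive semidefinite trace-class operators of trace `1`. -/
def IsDensity (T : TraceClass H) : Prop := T.toOp.IsPositive ∧ T.trace = 1

/-- The rank-one operator `|ψ⟩⟨ψ|`; for a unit vector `ψ` this is a pure state. -/
def pure (ψ : H) : TraceClass H :=
  mk (InnerProductSpace.rankOne ℂ ψ ψ) (by
    rw [traceNorm_rankOne]
    exact ENNReal.pow_lt_top enorm_lt_top)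

end TraceClass

/-- The quantum entropy `S(ρ) = -Tr [ρ log₂ ρ] ∈ [0, ∞]` of a density operator `ρ`; here
`-ρ log₂ ρ` is formed by the continuous functional calculus, with `0 log₂ 0 = 0`. -/
def entropy (ρ : H →L[ℂ] H) : ℝ≥0∞ :=
  posTrace (cfc (fun x : ℝ => -(x * Real.logb 2 x)) ρ)

end TraceClass

/-! ### Channels and instruments -/

section Channels

variable {H : Type*} [NormedAddCommGroup H] [InnerProductSpace ℂ H] [CompleteSpace H]
variable {G : Type*} [NormedAddCommGroup G] [InnerProductSpace ℂ G] [CompleteSpace G]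

/-- Positivity of the operator on `ℂᵏ ⊗ H = H ⊕ ⋯ ⊕ H` with blocks `T i j`. -/
def BlockPositive {k : ℕ} (T : Fin k → Fin k → TraceClass H) : Prop :=
  ∀ v : Fin k → H, 0 ≤ ∑ i, ∑ j, ⟪v i, (T i j).toOp (v j)⟫_ℂ

/-- Complete positivity: `I_k ⊗ E` is positive for all `k`. -/
def IsCompletelyPositive (E : TraceClass H →ₗ[ℂ] TraceClass G) : Prop :=
  ∀ (k : ℕ) (T : Fin k → Fin k → TraceClass H),
    BlockPositive T → BlockPositive fun i j => E (T i j)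

/-- The map preserves the trace. -/
def IsTracePreserving (E : TraceClass H →ₗ[ℂ] TraceClass G) : Prop :=
  ∀ T, (E T).trace = T.trace

/-- Quantum channels: completely positive trace-preserving maps `𝒯(H) → 𝒯(G)`. -/
def IsChannel (E : TraceClass H →ₗ[ℂ] TraceClass G) : Prop :=
  IsCompletelyPositive E ∧ IsTracePreserving E

/-- Instruments: families of completely positive maps that sum up (pointwise, in trace norm) to a
quantum channel. -/
def IsInstrument {ι : Type*} (E : ι → TraceClass H →ₗ[ℂ] TraceClass G) : Prop :=
  (∀ i, IsCompletelyPositive (E i)) ∧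
    ∃ F : TraceClass H →ₗ[ℂ] TraceClass G, IsChannel F ∧ ∀ T, HasSum (fun i => E i T) (F T)

end Channels

/-! ### Bipartite systems -/

section Bipartite

/-- The Hilbert space tensor product of `A` and `B`. -/
abbrev HTensor (A B : Type*) [NormedAddCommGroup A] [InnerProductSpace ℂ A]
    [NormedAddCommGroup B] [InnerProductSpace ℂ B] : Type _ :=
  UniformSpace.Completion (A ⊗[ℂ] B)

variable {A : Type*} [NormedAddCommGroup A] [InnerProductSpace ℂ A]
variable {B : Type*} [NormedAddCommGroup B] [InnerProductSpace ℂ B]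
variable {A' : Type*} [NormedAddCommGroup A'] [InnerProductSpace ℂ A']
variable {B' : Type*} [NormedAddCommGroup B'] [InnerProductSpace ℂ B']

/-- The operator `A → A ⊗ B`, `a ↦ a ⊗ b`, for a fixed vector `b`. -/
def tensorRight (b : B) : A →L[ℂ] HTensor A B :=
  UniformSpace.Completion.toComplL ∘L (TensorProduct.mkL ℂ A B).flip b

/-- The tensor product `L ⊗ M : A ⊗ B → A' ⊗ B'` of two bounded operators. -/
def opTensor (L : A →L[ℂ] A') (M : B →L[ℂ] B') : HTensor A B →L[ℂ] HTensor A' B' :=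
  (TensorProduct.mapL L M).completion

variable [CompleteSpace A] [CompleteSpace B] [CompleteSpace A'] [CompleteSpace B']

/-- The partial trace `Tr_B T = ∑ₙ (1 ⊗ ⟨n|) T (1 ⊗ |n⟩)`, with `n` running over an orthonormal
basis of `B`; for trace-class `T` the series converges absolutely. -/
def partialTrace (T : TraceClass (HTensor A B)) : A →L[ℂ] A :=
  ∑' j, ContinuousLinearMap.adjoint (tensorRight (onb B j)) ∘L T.toOp ∘L tensorRight (onb B j)

/-- Countably separable channels, with respect to `A : B` at the input and `A' : B'` at the output:
channels with a countable Kraus representation by product operators, converging in trace norm. -/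
def IsCountablySeparable
    (E : TraceClass (HTensor A B) →ₗ[ℂ] TraceClass (HTensor A' B')) : Prop :=
  IsChannel E ∧ ∃ (L : ℕ → A →L[ℂ] A') (M : ℕ → B →L[ℂ] B'),
    ∀ T, HasSum (fun k => TraceClass.conj (opTensor (L k) (M k)) T) (E T)

open Classical in
/-- The vector `|i⟩` of the standard basis of the classical register `X = ℓ²(ι)`. -/
def regVec {ι : Type*} (i : ι) : ℓ²(ι, ℂ) := lp.single 2 i (1 : ℂ)

/-- The map `T ↦ T ⊗ |i⟩⟨i|` that records the outcome `i` in the register `X`, which is held by the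
first party: the output system is `(A ⊗ X) ⊗ B`. -/
def recordOutcome {ι : Type*} (i : ι) :
    TraceClass (HTensor A B) →ₗ[ℂ] TraceClass (HTensor (HTensor A ℓ²(ι, ℂ)) B) :=
  TraceClass.conj (opTensor (tensorRight (regVec i)) (ContinuousLinearMap.id ℂ B))

/-- Countably separable instruments: the channel `ρ ↦ ∑ᵢ Eᵢ(ρ) ⊗ |i⟩⟨i|` is countably separable. -/
def IsCountablySeparableInstrument {ι : Type*}
    (E : ι → TraceClass (HTensor A B) →ₗ[ℂ] TraceClass (HTensor A' B')) : Prop :=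
  IsInstrument E ∧
    ∃ F : TraceClass (HTensor A B) →ₗ[ℂ] TraceClass (HTensor (HTensor A' ℓ²(ι, ℂ)) B'),
      (∀ T, HasSum (fun i => recordOutcome i (E i T)) (F T)) ∧ IsCountablySeparable F

/-- The entanglement of formation `E_f(ρ) ∈ [0, ∞]`: the infimum of `∑ₓ p(x) S(ψₓ^A)` over all
countable decompositions `ρ = ∑ₓ p(x) |ψₓ⟩⟨ψₓ|` into pure states. (A finite decomposition is padded
with weights zero.) -/
def entanglementOfFormation (ρ : TraceClass (HTensor A B)) : ℝ≥0∞ :=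
  ⨅ (p : ℕ → ℝ≥0) (ψ : ℕ → HTensor A B) (_ : HasSum p 1) (_ : ∀ x, ‖ψ x‖ = 1)
    (_ : HasSum (fun x => ((p x : ℝ) : ℂ) • TraceClass.pure (ψ x)) ρ),
    ∑' x, (p x : ℝ≥0∞) * entropy (partialTrace (TraceClass.pure (ψ x)))

end Bipartite

end EntForm

end

/-!
Both parts reduce to one inequality: if `K k = L k ⊗ M k` are countably many product operators with
`∑ₖ ‖K k η‖² = ‖η‖²` for all `η`, and `K k ψ = c k • φ k` with unit vectors `ψ`, `φ k`, then
`∑ₖ |c k|² S(φ k) ≤ S(ψ)`, where `S` is the entropy of the reduced state on the first party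
(`tsum_entropy_le`).

The entropy is written as an integral of truncated traces. Since
`x - x log x = ∫₀¹ min(x, t) dt / t` for `0 ≤ x ≤ 1`, a state `ρ` with entropy `S` (in nats) satisfies
`S + 1 = ∫₀¹ Tr min(ρ, t) dt / t`
(`entropy_mul_log_two_add_one`), so it is enough to compare truncated traces for each `t`. This
avoids sorted spectra and majorization, and it handles infinite entropies without extra care.

For a reduced state `ρ` of a vector `v`, the truncated trace is the minimum of
`‖((1 - P) ⊗ 1) v‖² + t · rank P` over the projections `P` of finite rank; the minimum is attained
by the spectral projection of `ρ` onto the eigenvalues that are at least `t` (`truncTrace_le`,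
`exists_le_truncTrace`). Let `P` be optimal for `ψ`, and let `P k` be the projection onto the image
of `ran P` under `L k`. Then `rank (P k) ≤ rank P` and `(1 - P k) (L k) P = 0`, so that
`‖((1 - P k) ⊗ 1) K k ψ‖ ≤ ‖K k ((1 - P) ⊗ 1) ψ‖`. Summing the squares over `k` gives
`‖((1 - P) ⊗ 1) ψ‖²` on the right, which is the required bound (`tsum_truncTrace_le`).

For an instrument, the Kraus operators of the outcome `x` are obtained by reading `x` off the
register; they map `ψ` to multiples of `φ x`, because `p x • |φ x⟩⟨φ x|` has rank one. For a
channel, the Kraus operators turn each decomposition of the input into one of the output.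
-/

namespace EntForm

/-! ### Product vectors and product operators -/

section ProductOperators

variable {A : Type*} [NormedAddCommGroup A] [InnerProductSpace ℂ A]
variable {B : Type*} [NormedAddCommGroup B] [InnerProductSpace ℂ B]
variable {A₁ : Type*} [NormedAddCommGroup A₁] [InnerProductSpace ℂ A₁]
variable {B₁ : Type*} [NormedAddCommGroup B₁] [InnerProductSpace ℂ B₁]
variable {A₂ : Type*} [NormedAddCommGroup A₂] [InnerProductSpace ℂ A₂]
variable {B₂ : Type*} [NormedAddCommGroup B₂] [InnerProductSpace ℂ B₂]

theorem tensorRight_apply (a : A) (b : B) :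
    tensorRight b a = ((a ⊗ₜ[ℂ] b : A ⊗[ℂ] B) : HTensor A B) := rfl

theorem opTensor_tensorRight (L : A →L[ℂ] A₁) (M : B →L[ℂ] B₁) (a : A) (b : B) :
    opTensor L M (tensorRight b a) = tensorRight (M b) (L a) := by
  rw [tensorRight_apply, opTensor, ContinuousLinearMap.completion_apply_coe]
  rfl

theorem inner_tensorRight (a a' : A) (b b' : B) :
    ⟪tensorRight b a, tensorRight b' a'⟫_ℂ = ⟪a, a'⟫_ℂ * ⟪b, b'⟫_ℂ := by
  rw [tensorRight_apply, tensorRight_apply, UniformSpace.Completion.inner_coe,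
    TensorProduct.inner_tmul]

/-- Bounded operators on `A ⊗ B` are determined by their values on product vectors. -/
theorem HTensor.clm_ext {G : Type*} [NormedAddCommGroup G] [NormedSpace ℂ G]
    {S T : HTensor A B →L[ℂ] G}
    (h : ∀ a b, S (tensorRight b a) = T (tensorRight b a)) : S = T := by
  ext v
  induction v using UniformSpace.Completion.induction_on with
  | hp => exact isClosed_eq S.continuous T.continuous
  | ih x =>
    induction x using TensorProduct.induction_on with
    | zero => rw [UniformSpace.Completion.coe_zero, map_zero, map_zero]
    | tmul a b => exact h a b
    | add x y hx hy => rw [UniformSpace.Completion.coe_add, map_add, map_add, hx, hy]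

theorem opTensor_comp (L' : A₁ →L[ℂ] A₂) (M' : B₁ →L[ℂ] B₂) (L : A →L[ℂ] A₁)
    (M : B →L[ℂ] B₁) :
    opTensor L' M' ∘L opTensor L M = opTensor (L' ∘L L) (M' ∘L M) :=
  HTensor.clm_ext fun a b => by
    simp only [ContinuousLinearMap.comp_apply, opTensor_tensorRight]

theorem opTensor_id : opTensor (ContinuousLinearMap.id ℂ A) (ContinuousLinearMap.id ℂ B) =
    ContinuousLinearMap.id ℂ (HTensor A B) :=
  HTensor.clm_ext fun a b => by
    rw [opTensor_tensorRight]
    rfl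

theorem norm_opTensor_apply_le (L : A →L[ℂ] A₁) (M : B →L[ℂ] B₁) (v : HTensor A B) :
    ‖opTensor L M v‖ ≤ ‖L‖ * ‖M‖ * ‖v‖ := by
  induction v using UniformSpace.Completion.induction_on with
  | hp => exact isClosed_le (by fun_prop) (by fun_prop)
  | ih x =>
    rw [opTensor, ContinuousLinearMap.completion_apply_coe, UniformSpace.Completion.norm_coe,
      UniformSpace.Completion.norm_coe]
    exact (ContinuousLinearMap.le_opNorm _ _).trans
      (mul_le_mul_of_nonneg_right (TensorProduct.norm_mapL_le L M) (norm_nonneg _))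

theorem clm_ext_hilbertBasis {ι : Type*} (e : HilbertBasis ι ℂ A) {G : Type*}
    [NormedAddCommGroup G] [NormedSpace ℂ G] {S T : A →L[ℂ] G} (h : ∀ i, S (e i) = T (e i)) :
    S = T := by
  refine ContinuousLinearMap.ext_on
    (Submodule.dense_iff_topologicalClosure_eq_top.2 e.dense_span) ?_
  rintro _ ⟨i, rfl⟩
  exact h i

/-- The product basis of `A ⊗ B`, consisting of the vectors `e i ⊗ f j`. -/
noncomputable def tensorBasis {ι κ : Type*} (e : HilbertBasis ι ℂ A) (f : HilbertBasis κ ℂ B) :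
    HilbertBasis (ι × κ) ℂ (HTensor A B) :=
  HilbertBasis.mkOfOrthogonalEqBot (v := fun x : ι × κ => tensorRight (f x.2) (e x.1))
    (by
      classical
      rw [orthonormal_iff_ite]
      rintro ⟨i, j⟩ ⟨i', j'⟩
      rw [inner_tensorRight, orthonormal_iff_ite.1 e.orthonormal,
        orthonormal_iff_ite.1 f.orthonormal]
      by_cases h1 : i = i' <;> by_cases h2 : j = j' <;> simp [h1, h2])
    (by
      rw [Submodule.eq_bot_iff]
      intro v hv
      have h0 : ∀ i j, ⟪v, tensorRight (f j) (e i)⟫_ℂ = 0 := fun i j =>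
        Submodule.inner_left_of_mem_orthogonal
          (Submodule.subset_span (Set.mem_range_self (i, j))) hv
      -- The functional `⟪v, ·⟫` vanishes on `e i ⊗ f j`; extend this in one factor at a time.
      have h1 : ∀ a j, ⟪v, tensorRight (f j) a⟫_ℂ = 0 := fun a j => by
        have : innerSL ℂ v ∘L tensorRight (f j) = (0 : A →L[ℂ] ℂ) :=
          clm_ext_hilbertBasis e fun i => h0 i j
        exact congrArg (fun g => g a) this
      have h2 : ∀ a b, ⟪v, tensorRight b a⟫_ℂ = 0 := fun a b => by
        have : innerSL ℂ v ∘L UniformSpace.Completion.toComplL ∘L TensorProduct.mkL ℂ A B a =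
            (0 : B →L[ℂ] ℂ) := clm_ext_hilbertBasis f fun j => h1 a j
        exact congrArg (fun g => g b) this
      have h3 : innerSL ℂ v = 0 := HTensor.clm_ext fun a b => h2 a b
      exact inner_self_eq_zero.1 (congrArg (fun g => g v) h3))

theorem tensorBasis_apply {ι κ : Type*} (e : HilbertBasis ι ℂ A) (f : HilbertBasis κ ℂ B)
    (x : ι × κ) : tensorBasis e f x = tensorRight (f x.2) (e x.1) := by
  rw [tensorBasis, HilbertBasis.coe_mkOfOrthogonalEqBot]

/-- Parseval's identity in the product basis. -/
theorem tsum_tsum_enorm_inner_tensorRight_sq {ι κ : Type*} (e : HilbertBasis ι ℂ A)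
    (f : HilbertBasis κ ℂ B) (v : HTensor A B) :
    ∑' i, ∑' j, ‖⟪tensorRight (f j) (e i), v⟫_ℂ‖ₑ ^ 2 = ‖v‖ₑ ^ 2 := by
  rw [← tsum_enorm_inner_sq (tensorBasis e f) v,
    ← ENNReal.tsum_prod (f := fun i j => ‖⟪tensorRight (f j) (e i), v⟫_ℂ‖ₑ ^ 2)]
  simp only [tensorBasis_apply]

variable [CompleteSpace A]

theorem adjoint_tensorRight_comp_tensorRight (b b' : B) :
    ContinuousLinearMap.adjoint (tensorRight b) ∘L tensorRight (A := A) b' =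
      ⟪b, b'⟫_ℂ • ContinuousLinearMap.id ℂ A := by
  ext a
  refine ext_inner_left ℂ fun x => ?_
  rw [ContinuousLinearMap.comp_apply, ContinuousLinearMap.adjoint_inner_right, inner_tensorRight,
    smul_apply, inner_smul_right, ContinuousLinearMap.id_apply, mul_comm]

variable [CompleteSpace B] [CompleteSpace A₁] [CompleteSpace B₁]

theorem inner_tensorRight_opTensor (L : A →L[ℂ] A₁) (M : B →L[ℂ] B₁) (a : A₁) (b : B₁)
    (v : HTensor A B) :
    ⟪tensorRight b a, opTensor L M v⟫_ℂ =
      ⟪tensorRight (ContinuousLinearMap.adjoint M b) (ContinuousLinearMap.adjoint L a), v⟫_ℂ := by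
  have h : innerSL ℂ (tensorRight b a) ∘L opTensor L M = innerSL ℂ
      (tensorRight (ContinuousLinearMap.adjoint M b) (ContinuousLinearMap.adjoint L a)) :=
    HTensor.clm_ext fun x y => by
      simp only [ContinuousLinearMap.comp_apply, opTensor_tensorRight, innerSL_apply_apply,
        inner_tensorRight, ContinuousLinearMap.adjoint_inner_left]
  exact congrArg (fun f => f v) h

end ProductOperators

/-! ### Trace-norm continuity -/

section TraceNorm

variable {H : Type*} [NormedAddCommGroup H] [InnerProductSpace ℂ H] [CompleteSpace H]
variable {G : Type*} [NormedAddCommGroup G] [InnerProductSpace ℂ G] [CompleteSpace G]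
variable {K : Type*} [NormedAddCommGroup K] [InnerProductSpace ℂ K] [CompleteSpace K]

namespace TraceClass

theorem tsum_enorm_diag_le (T : TraceClass H) :
    ∑' i, ‖⟪onb H i, T.toOp (onb H i)⟫_ℂ‖ₑ ≤ traceNorm T.toOp := by
  have h1 : ‖ContinuousLinearMap.id ℂ H‖ₑ ≤ 1 := by
    rw [← ofReal_norm]
    exact ENNReal.ofReal_le_one.2 ContinuousLinearMap.norm_id_le
  refine (tsum_inner_le (onb H) T.toOp (ContinuousLinearMap.id ℂ H)
    (ContinuousLinearMap.id ℂ H)).trans ?_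
  exact (mul_le_mul_left (mul_le_one' h1 h1) _).trans (one_mul _).le

theorem summable_diag (T : TraceClass H) :
    Summable fun i => ‖⟪onb H i, T.toOp (onb H i)⟫_ℂ‖ := by
  have h := (T.tsum_enorm_diag_le.trans_lt T.traceNorm_lt_top).ne
  simpa only [toReal_enorm] using ENNReal.summable_toReal h

variable (H) in
/-- The trace as a continuous functional on the trace-class operators. -/
noncomputable def traceCLM : TraceClass H →L[ℂ] ℂ :=
  LinearMap.mkContinuous
    { toFun := trace
      map_add' := fun S T => by
        simp only [trace, map_add, add_apply, inner_add_right]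
        exact S.summable_diag.of_norm.tsum_add T.summable_diag.of_norm
      map_smul' := fun a T => by
        simp only [trace, map_smul, smul_apply, inner_smul_right, tsum_mul_left, RingHom.id_apply,
          smul_eq_mul] }
    1 fun T => by
      rw [one_mul]
      refine (norm_tsum_le_tsum_norm T.summable_diag).trans ?_
      rw [norm_def]
      refine le_trans (le_of_eq ?_)
        (ENNReal.toReal_mono T.traceNorm_lt_top.ne T.tsum_enorm_diag_le)
      rw [ENNReal.tsum_toReal_eq fun i => enorm_ne_top]
      simp only [toReal_enorm]

theorem traceCLM_apply (T : TraceClass H) : traceCLM H T = T.trace := rfl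

/-- `T ↦ K T K†` as a continuous map for the trace norm. -/
noncomputable def conjCLM (L : H →L[ℂ] G) : TraceClass H →L[ℂ] TraceClass G :=
  LinearMap.mkContinuous (conj L) (‖L‖ * ‖L‖) fun T => by
    have h := ENNReal.toReal_mono
      (ENNReal.mul_lt_top (ENNReal.mul_lt_top enorm_lt_top enorm_lt_top) T.traceNorm_lt_top).ne
      (traceNorm_sandwich_le L L T.toOp)
    rwa [ENNReal.toReal_mul, ENNReal.toReal_mul, toReal_enorm] at h

theorem conjCLM_apply (L : H →L[ℂ] G) (T : TraceClass H) : conjCLM L T = conj L T := rfl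

theorem toOp_conj (L : H →L[ℂ] G) (T : TraceClass H) :
    (conj L T).toOp = L ∘L T.toOp ∘L ContinuousLinearMap.adjoint L := rfl

theorem toOp_pure (v : H) : (pure v).toOp = InnerProductSpace.rankOne ℂ v v := rfl

theorem conj_conj (L : G →L[ℂ] K) (M : H →L[ℂ] G) (T : TraceClass H) :
    conj L (conj M T) = conj (L ∘L M) T :=
  toOp_injective <| by
    simp only [toOp_conj, ContinuousLinearMap.adjoint_comp, ContinuousLinearMap.comp_assoc]

theorem conj_pure (L : H →L[ℂ] G) (v : H) : conj L (pure v) = pure (L v) :=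
  toOp_injective <| by
    ext x
    simp only [toOp_conj, toOp_pure, ContinuousLinearMap.comp_apply,
      InnerProductSpace.rankOne_apply, map_smul, ContinuousLinearMap.adjoint_inner_right]

theorem pure_smul (c : ℂ) (v : H) : pure (c • v) = ((‖c‖ ^ 2 : ℝ) : ℂ) • pure v :=
  toOp_injective <| by
    ext x
    rw [map_smul]
    simp only [toOp_pure, InnerProductSpace.rankOne_apply, smul_apply, inner_smul_left, smul_smul]
    rw [mul_right_comm, ← Complex.normSq_eq_conj_mul_self, Complex.normSq_eq_norm_sq]

theorem trace_pure (v : H) : (pure v).trace = ((‖v‖ ^ 2 : ℝ) : ℂ) := by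
  have h := (onb H).tsum_inner_mul_inner v v
  rw [inner_self_eq_norm_sq_to_K] at h
  simp only [trace, toOp_pure, InnerProductSpace.rankOne_apply, inner_smul_right]
  rw [h]
  norm_cast

theorem norm_pure (v : H) : ‖pure v‖ = ‖v‖ ^ 2 := by
  rw [norm_def, toOp_pure, traceNorm_rankOne, ENNReal.toReal_pow, toReal_enorm]

/-- Taking traces in a decomposition into rank-one operators. -/
theorem tsum_enorm_sq_of_hasSum_pure {ι : Type*} {v : ι → H} {T : TraceClass H} {r : ℝ}
    (h : HasSum (fun i => pure (v i)) T) (hT : T.trace = (r : ℂ)) :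
    ∑' i, ‖v i‖ₑ ^ 2 = ENNReal.ofReal r := by
  have h1 := h.mapL (traceCLM H)
  simp only [traceCLM_apply, trace_pure, hT] at h1
  have h2 : HasSum (fun i => ‖v i‖ ^ 2) r := Complex.hasSum_ofReal.1 h1
  rw [← h2.tsum_eq, ENNReal.ofReal_tsum_of_nonneg (fun i => by positivity) h2.summable]
  simp only [ENNReal.ofReal_pow (norm_nonneg _), ofReal_norm]

/-- The vectors in a decomposition of a multiple of `|φ⟩⟨φ|` into rank-one operators are multiples
of `φ`, because every operator that annihilates `φ` annihilates them. -/
theorem exists_smul_of_hasSum_pure {ι : Type*} {v : ι → H} {φ : H} {p : ℝ} (hφ : ‖φ‖ = 1)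
    (h : HasSum (fun i => pure (v i)) ((p : ℂ) • pure φ)) (i : ι) : ∃ c : ℂ, v i = c • φ := by
  -- `Q` projects onto the orthogonal complement of `φ`.
  let Q : H →L[ℂ] H := ContinuousLinearMap.id ℂ H - InnerProductSpace.rankOne ℂ φ φ
  have hQ : ∀ x, Q x = x - ⟪φ, x⟫_ℂ • φ := fun x => rfl
  have hφ0 : Q φ = 0 := by
    rw [hQ, inner_self_eq_norm_sq_to_K, hφ]
    simp
  have h1 := h.mapL (conjCLM Q)
  simp only [map_smul, conjCLM_apply, conj_pure, hφ0] at h1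
  have h2 := tsum_enorm_sq_of_hasSum_pure (r := 0) h1 (by
    rw [← traceCLM_apply, map_smul, traceCLM_apply, trace_pure]
    simp)
  rw [ENNReal.ofReal_zero, ENNReal.tsum_eq_zero] at h2
  have h3 : Q (v i) = 0 := by simpa using h2 i
  exact ⟨⟪φ, v i⟫_ℂ, sub_eq_zero.1 ((hQ _).symm.trans h3)⟩

end TraceClass

end TraceNorm

/-! ### Diagonalization of positive compact operators -/

section Diagonalization

universe u

variable {A : Type*} [NormedAddCommGroup A] [InnerProductSpace ℂ A]

theorem isCompactOperator_rankOne (x y : A) :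
    IsCompactOperator (InnerProductSpace.rankOne ℂ x y) := by
  have h : IsCompactOperator (innerSL ℂ y : A →L[ℂ] ℂ) :=
    (isCompactOperator_id (E := ℂ)).comp_clm (innerSL ℂ y)
  exact h.clm_comp (ContinuousLinearMap.toSpanSingleton ℂ x)

/-- A diagonalized operator as a quadratic form. -/
theorem hasSum_inner_eigenbasis {ι : Type*} {T : A →L[ℂ] A} (hT : T.IsPositive)
    (e : HilbertBasis ι ℂ A) {l : ι → ℝ≥0} (hl : ∀ i, T (e i) = ((l i : ℝ) : ℂ) • e i) (x : A) :
    HasSum (fun i => (l i : ℝ) * ‖⟪e i, x⟫_ℂ‖ ^ 2) (⟪x, T x⟫_ℂ).re := by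
  have h := e.hasSum_inner_mul_inner x (T x)
  have h1 : ∀ i, ⟪x, e i⟫_ℂ * ⟪e i, T x⟫_ℂ = (((l i : ℝ) * ‖⟪e i, x⟫_ℂ‖ ^ 2 : ℝ) : ℂ) := by
    intro i
    have h2 : ⟪e i, T x⟫_ℂ = ⟪T (e i), x⟫_ℂ := (hT.isSymmetric (e i) x).symm
    rw [h2, hl, inner_smul_left, ← inner_conj_symm, mul_left_comm,
      ← Complex.normSq_eq_conj_mul_self, Complex.normSq_eq_norm_sq, Complex.conj_ofReal,
      Complex.ofReal_mul]
  simp only [h1] at h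
  exact Complex.hasSum_re h

variable [CompleteSpace A]

/-- The spectral theorem for positive compact operators: there is a Hilbert basis of
eigenvectors. -/
theorem exists_eigenbasis {A : Type u} [NormedAddCommGroup A] [InnerProductSpace ℂ A]
    [CompleteSpace A] {T : A →L[ℂ] A} (hc : IsCompactOperator T) (hT : T.IsPositive) :
    ∃ (ι : Type u) (e : HilbertBasis ι ℂ A) (l : ι → ℝ≥0),
      ∀ i, T (e i) = ((l i : ℝ) : ℂ) • e i := by
  -- The union of Hilbert bases of all eigenspaces is orthonormal and has dense span.
  let V : ℂ → Submodule ℂ A := fun μ => Module.End.eigenspace (T : Module.End ℂ A) μ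
  have hV : ∀ μ, CompleteSpace (V μ) := fun μ => by
    have h : (V μ : Set A) = {x | T x = μ • x} := by
      ext x
      exact Module.End.mem_eigenspace_iff
    have h' : IsClosed (V μ : Set A) := by
      rw [h]
      exact isClosed_eq T.continuous (by fun_prop)
    exact h'.completeSpace_coe
  choose w b hb using fun μ => exists_hilbertBasis ℂ (V μ)
  have ho := (hT.isSymmetric.orthogonalFamily_eigenspaces).orthonormal_sigma_orthonormal
    (fun μ => (b μ).orthonormal)
  let e : HilbertBasis (Σ μ, w μ) ℂ A := HilbertBasis.mkOfOrthogonalEqBot ho (by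
    rw [eq_bot_iff, 
      ← ContinuousLinearMap.orthogonalComplement_iSup_eigenspaces_eq_bot hc hT.isSymmetric,
      ← Submodule.iInf_orthogonal, le_iInf_iff]
    intro μ x hx
    rw [Submodule.mem_orthogonal']
    intro y hy
    have h : innerSL ℂ x ∘L (V μ).subtypeL = (0 : V μ →L[ℂ] ℂ) :=
      clm_ext_hilbertBasis (b μ) fun i => Submodule.inner_left_of_mem_orthogonal
        (Submodule.subset_span (Set.mem_range_self (⟨μ, i⟩ : Σ μ, w μ))) hx
    exact congrArg (fun g => g ⟨y, hy⟩) h)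
  have he : ∀ i, T (e i) = i.1 • e i := fun i => by
    have h : e i = (b i.1 i.2 : A) := congrFun (HilbertBasis.coe_mkOfOrthogonalEqBot ho _) i
    rw [h]
    exact Module.End.mem_eigenspace_iff.1 (b i.1 i.2).2
  have hpos : ∀ i : Σ μ, w μ, 0 ≤ i.1 := fun i => by
    have h := hT.inner_nonneg_right (e i)
    rwa [he, inner_smul_right, inner_self_eq_norm_sq_to_K, e.orthonormal.1 i, RCLike.ofReal_one,
      one_pow, mul_one] at h
  refine ⟨_, e, fun i => ⟨i.1.re, (Complex.nonneg_iff.1 (hpos i)).1⟩, fun i => ?_⟩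
  rw [he]
  congr 1
  exact Complex.ext rfl (Complex.nonneg_iff.1 (hpos i)).2.symm

/-- Eigenvectors of `T` are eigenvectors of `f(T)`. -/
theorem cfc_apply_eigenvector {T : A →L[ℂ] A} (hT : IsSelfAdjoint T) {f : ℝ → ℝ}
    (hf : Continuous f) {x : A} {r : ℝ} (hx : T x = (r : ℂ) • x) :
    cfc f T x = (f r : ℂ) • x := by
  rcases eq_or_ne x 0 with rfl | hx0
  · simp
  have hr : r ∈ spectrum ℝ T := by
    intro h
    obtain ⟨S, hS⟩ := h.exists_left_inv
    have h1 : (algebraMap ℝ (A →L[ℂ] A) r - T) x = 0 := by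
      rw [sub_apply, hx, Algebra.algebraMap_eq_smul_one, smul_apply]
      exact sub_eq_zero.2 (Complex.coe_smul r x).symm
    have h2 := congrArg (fun g => g x) hS
    rw [ContinuousLinearMap.mul_def] at h2
    simp only [ContinuousLinearMap.comp_apply, h1, map_zero] at h2
    exact hx0 h2.symm
  -- The claim holds for polynomials and passes to uniform limits.
  have key : ∀ g : C(spectrum ℝ T, ℝ), cfcHom hT g x = (g ⟨r, hr⟩ : ℂ) • x := by
    intro g
    induction g using ContinuousMap.induction_on_of_compact with
    | const s =>
      have h : ContinuousMap.const (spectrum ℝ T) s = algebraMap ℝ C(spectrum ℝ T, ℝ) s := rfl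
      rw [h, AlgHomClass.commutes, Algebra.algebraMap_eq_smul_one, smul_apply]
      exact (Complex.coe_smul s x).symm
    | id =>
      rw [cfcHom_id hT, hx]
      rfl
    | star_id =>
      rw [map_star, cfcHom_id hT, hT.star_eq, hx]
      rfl
    | add g h hg hh =>
      rw [map_add, add_apply, hg, hh, ← add_smul, ContinuousMap.add_apply, Complex.ofReal_add]
    | mul g h hg hh =>
      rw [map_mul, ContinuousLinearMap.mul_def, ContinuousLinearMap.comp_apply, hh, map_smul, hg,
        smul_smul, ContinuousMap.mul_apply, Complex.ofReal_mul, mul_comm]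
    | frequently g hg =>
      have hcl : IsClosed {g : C(spectrum ℝ T, ℝ) | cfcHom hT g x = (g ⟨r, hr⟩ : ℂ) • x} := by
        refine isClosed_eq ?_ ?_
        · have := cfcHom_continuous (R := ℝ) hT
          fun_prop
        · have : Continuous fun g : C(spectrum ℝ T, ℝ) => g ⟨r, hr⟩ :=
            continuous_eval_const _
          fun_prop
      exact hcl.mem_of_frequently_of_tendsto hg Filter.tendsto_id
  rw [cfc_apply f T hT hf.continuousOn]
  exact key _

/-- The trace of a function of a diagonalized positive operator. The function has to be nonnegative
only on `[0, ‖T‖]`, which contains the spectrum; `-x log x` is negative beyond `1`. -/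
theorem posTrace_cfc {ι : Type*} {T : A →L[ℂ] A} (hT : T.IsPositive) (e : HilbertBasis ι ℂ A)
    {l : ι → ℝ≥0} (hl : ∀ i, T (e i) = ((l i : ℝ) : ℂ) • e i) {f : ℝ → ℝ} (hf : Continuous f)
    (hf0 : ∀ x, 0 ≤ x → x ≤ ‖T‖ → 0 ≤ f x) :
    posTrace (cfc f T) = ∑' i, ENNReal.ofReal (f (l i)) := by
  have h0 : 0 ≤ cfc f T := cfc_nonneg fun x hx => by
    have h1 : 0 ≤ x := 
      spectrum_nonneg_of_nonneg ((ContinuousLinearMap.nonneg_iff_isPositive T).2 hT) hx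
    refine hf0 x h1 ?_
    have h2 := spectrum.norm_le_norm_mul_of_mem hx
    rw [Real.norm_of_nonneg h1] at h2
    exact h2.trans (mul_le_of_le_one_right (norm_nonneg _) ContinuousLinearMap.norm_id_le)
  rw [posTrace_eq e h0]
  refine tsum_congr fun i => ?_
  rw [cfc_apply_eigenvector hT.isSelfAdjoint hf (hl i), inner_smul_right,
    inner_self_eq_norm_sq_to_K, e.orthonormal.1 i]
  simp

end Diagonalization

/-! ### Reduced states of vectors -/

section ReducedState

variable {A : Type*} [NormedAddCommGroup A] [InnerProductSpace ℂ A] [CompleteSpace A]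
variable {B : Type*} [NormedAddCommGroup B] [InnerProductSpace ℂ B]
variable {A₁ : Type*} [NormedAddCommGroup A₁] [InnerProductSpace ℂ A₁] [CompleteSpace A₁]

theorem adjoint_tensorRight_inner (b : B) (a : A) (v : HTensor A B) :
    ⟪a, ContinuousLinearMap.adjoint (tensorRight b) v⟫_ℂ = ⟪tensorRight b a, v⟫_ℂ :=
  ContinuousLinearMap.adjoint_inner_right _ _ _

variable [CompleteSpace B]

theorem tsum_enorm_adjoint_tensorRight_sq (v : HTensor A B) :
    ∑' j, ‖ContinuousLinearMap.adjoint (tensorRight (A := A) (onb B j)) v‖ₑ ^ 2 = ‖v‖ₑ ^ 2 := by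
  simp only [← tsum_enorm_inner_sq (onb A), adjoint_tensorRight_inner]
  rw [ENNReal.tsum_comm, tsum_tsum_enorm_inner_tensorRight_sq]

/-- The series that defines the reduced state of a vector converges in operator norm. -/
theorem hasSum_partialTrace_pure (v : HTensor A B) :
    HasSum (fun j => InnerProductSpace.rankOne ℂ
        (ContinuousLinearMap.adjoint (tensorRight (A := A) (onb B j)) v)
        (ContinuousLinearMap.adjoint (tensorRight (A := A) (onb B j)) v))
      (partialTrace (TraceClass.pure v)) := by
  have h1 : ∀ j, ContinuousLinearMap.adjoint (tensorRight (A := A) (onb B j)) ∘L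
      (TraceClass.pure v).toOp ∘L tensorRight (onb B j) = InnerProductSpace.rankOne ℂ
        (ContinuousLinearMap.adjoint (tensorRight (A := A) (onb B j)) v)
        (ContinuousLinearMap.adjoint (tensorRight (A := A) (onb B j)) v) := fun j => by
    ext x
    simp only [TraceClass.toOp_pure, ContinuousLinearMap.comp_apply,
      InnerProductSpace.rankOne_apply, map_smul, ContinuousLinearMap.adjoint_inner_left]
  have h2 : Summable fun j => InnerProductSpace.rankOne ℂ
        (ContinuousLinearMap.adjoint (tensorRight (A := A) (onb B j)) v)
        (ContinuousLinearMap.adjoint (tensorRight (A := A) (onb B j)) v) := by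
    refine Summable.of_norm ?_
    have h3 : ∑' j, ‖ContinuousLinearMap.adjoint (tensorRight (A := A) (onb B j)) v‖ₑ ^ 2 ≠ ∞ := by
      rw [tsum_enorm_adjoint_tensorRight_sq]
      exact (ENNReal.pow_lt_top enorm_lt_top).ne
    have h4 := ENNReal.summable_toReal h3
    simp only [ENNReal.toReal_pow, toReal_enorm] at h4
    simpa only [InnerProductSpace.norm_rankOne, ← sq] using h4
  have h3 := h2.hasSum
  simp only [partialTrace, h1]
  exact h3

theorem hasSum_inner_partialTrace_pure (v : HTensor A B) (a : A) :
    HasSum (fun j => ((‖⟪tensorRight (onb B j) a, v⟫_ℂ‖ ^ 2 : ℝ) : ℂ))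
      ⟪a, partialTrace (TraceClass.pure v) a⟫_ℂ := by
  have h := ((hasSum_partialTrace_pure v).mapL
    (ContinuousLinearMap.apply ℂ A a)).mapL (innerSL ℂ a)
  have h1 : ∀ x : A, ⟪x, a⟫_ℂ * ⟪a, x⟫_ℂ = ((‖⟪a, x⟫_ℂ‖ ^ 2 : ℝ) : ℂ) := fun x => by
    rw [← inner_conj_symm, ← Complex.normSq_eq_conj_mul_self, Complex.normSq_eq_norm_sq]
  simp only [ContinuousLinearMap.apply_apply, innerSL_apply_apply,
    InnerProductSpace.rankOne_apply, inner_smul_right, h1] at h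
  simpa only [adjoint_tensorRight_inner] using h

theorem isPositive_partialTrace_pure (v : HTensor A B) :
    (partialTrace (TraceClass.pure v)).IsPositive := by
  rw [ContinuousLinearMap.isPositive_iff_complex]
  intro a
  have h := hasSum_inner_partialTrace_pure v a
  have hr : HasSum (fun j => ‖⟪tensorRight (onb B j) a, v⟫_ℂ‖ ^ 2)
      (⟪a, partialTrace (TraceClass.pure v) a⟫_ℂ).re := Complex.hasSum_re h
  have hi : ⟪a, partialTrace (TraceClass.pure v) a⟫_ℂ =
      ((⟪a, partialTrace (TraceClass.pure v) a⟫_ℂ).re : ℂ) :=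
    h.unique (Complex.hasSum_ofReal.2 hr)
  have h0 : 0 ≤ (⟪a, partialTrace (TraceClass.pure v) a⟫_ℂ).re :=
    hr.nonneg fun j => by positivity
  rw [← inner_conj_symm, hi, Complex.conj_ofReal]
  exact ⟨rfl, h0⟩

theorem norm_partialTrace_pure_le (v : HTensor A B) :
    ‖partialTrace (TraceClass.pure v)‖ ≤ ‖v‖ ^ 2 := by
  have h := tsum_enorm_adjoint_tensorRight_sq v
  have h1 : ∑' j, ‖ContinuousLinearMap.adjoint (tensorRight (A := A) (onb B j)) v‖ₑ ^ 2 ≠ ∞ := by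
    rw [h]
    exact (ENNReal.pow_lt_top enorm_lt_top).ne
  have h2 := ENNReal.summable_toReal h1
  have h3 := congrArg ENNReal.toReal h
  rw [ENNReal.tsum_toReal_eq fun j => (ENNReal.pow_lt_top enorm_lt_top).ne] at h3
  simp only [ENNReal.toReal_pow, toReal_enorm] at h2 h3
  rw [← (hasSum_partialTrace_pure v).tsum_eq, ← h3]
  refine tsum_of_norm_bounded h2.hasSum fun j => ?_
  rw [InnerProductSpace.norm_rankOne, sq]

theorem isCompactOperator_partialTrace_pure (v : HTensor A B) :
    IsCompactOperator (partialTrace (TraceClass.pure v)) :=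
  isCompactOperator_of_tendsto (hasSum_partialTrace_pure v)
    (Filter.Eventually.of_forall fun _ =>
      (compactOperator (RingHom.id ℂ) A A).sum_mem fun _ _ => isCompactOperator_rankOne _ _)

/-- In an eigenbasis `e` of the reduced state of `v`, with eigenvalues `l`, the squared norm of
`(Q ⊗ 1) v` is the trace of `Q ρ Q†`. -/
theorem tsum_eigenvalue_mul_enorm_sq (v : HTensor A B) {ι : Type*} (e : HilbertBasis ι ℂ A)
    {l : ι → ℝ≥0}
    (hl : ∀ i, partialTrace (TraceClass.pure v) (e i) = ((l i : ℝ) : ℂ) • e i)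
    (Q : A →L[ℂ] A₁) :
    ∑' i, (l i : ℝ≥0∞) * ‖Q (e i)‖ₑ ^ 2 =
      ‖opTensor Q (ContinuousLinearMap.id ℂ B) v‖ₑ ^ 2 := by
  -- Both sides are `⟪a, ρ a⟫` for the reduced state `ρ`.
  have h1 : ∀ a : A, ∑' j, ‖⟪tensorRight (onb B j) a, v⟫_ℂ‖ₑ ^ 2 =
      ∑' i, (l i : ℝ≥0∞) * ‖⟪e i, a⟫_ℂ‖ₑ ^ 2 := by
    intro a
    have h2 := hasSum_inner_eigenbasis (isPositive_partialTrace_pure v) e hl a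
    have h3 : HasSum (fun j => ‖⟪tensorRight (onb B j) a, v⟫_ℂ‖ ^ 2)
        (⟪a, partialTrace (TraceClass.pure v) a⟫_ℂ).re :=
      Complex.hasSum_re (hasSum_inner_partialTrace_pure v a)
    have h4 := h3.tsum_eq.trans h2.tsum_eq.symm
    have h5 := congrArg ENNReal.ofReal h4
    rw [ENNReal.ofReal_tsum_of_nonneg (fun i => by positivity) h3.summable,
      ENNReal.ofReal_tsum_of_nonneg (fun i => by positivity) h2.summable] at h5
    simpa only [ENNReal.ofReal_mul (NNReal.coe_nonneg _), ENNReal.ofReal_pow (norm_nonneg _),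
      ofReal_norm, ENNReal.ofReal_coe_nnreal] using h5
  rw [← tsum_tsum_enorm_inner_tensorRight_sq (onb A₁) (onb B)]
  simp only [inner_tensorRight_opTensor, ContinuousLinearMap.adjoint_id,
    ContinuousLinearMap.id_apply, h1]
  rw [ENNReal.tsum_comm]
  refine tsum_congr fun i => ?_
  rw [ENNReal.tsum_mul_left]
  simp only [ContinuousLinearMap.adjoint_inner_right]
  rw [← tsum_enorm_inner_sq (onb A₁)]
  congr 1
  refine tsum_congr fun j => ?_
  rw [← inner_conj_symm]
  simp only [← ofReal_norm, RCLike.norm_conj]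

end ReducedState

/-! ### Entropy as an integral of truncated traces -/

section Entropy

/-- `Tr min(T, t)`, the trace of the positive operator `T` with its spectrum cut off at `t`. -/
noncomputable def truncTrace {A : Type*} [NormedAddCommGroup A] [InnerProductSpace ℂ A]
    [CompleteSpace A] (T : A →L[ℂ] A) (t : ℝ) : ℝ≥0∞ :=
  posTrace (cfc (fun x : ℝ => min x t) T)

/-- Integrating `min x t / t` over `0 < t ≤ 1` gives `x - x log x`. -/
theorem lintegral_min_div {x : ℝ} (h0 : 0 ≤ x) (h1 : x ≤ 1) :
    ∫⁻ t in Set.Ioc (0 : ℝ) 1, ENNReal.ofReal (min x t) / ENNReal.ofReal t =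
      ENNReal.ofReal (-(x * Real.log x)) + ENNReal.ofReal x := by
  have ha : ∫⁻ t in Set.Ioc (0 : ℝ) x, ENNReal.ofReal (min x t) / ENNReal.ofReal t =
      ENNReal.ofReal x := by
    rw [MeasureTheory.setLIntegral_congr_fun (g := fun _ => 1) measurableSet_Ioc]
    · simp
    · intro t ht
      change ENNReal.ofReal (min x t) / ENNReal.ofReal t = 1
      rw [min_eq_right ht.2]
      exact ENNReal.div_self (ENNReal.ofReal_pos.2 ht.1).ne' ENNReal.ofReal_ne_top
  have hb : ∫⁻ t in Set.Ioc x 1, ENNReal.ofReal (min x t) / ENNReal.ofReal t =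
      ENNReal.ofReal (-(x * Real.log x)) := by
    rcases h0.eq_or_lt with rfl | hx
    · rw [MeasureTheory.setLIntegral_congr_fun (g := fun _ => 0) measurableSet_Ioc]
      · simp
      · intro t ht
        simp [min_eq_left ht.1.le]
    · have hi : IntervalIntegrable (fun t : ℝ => x * t⁻¹) MeasureTheory.volume x 1 := by
        refine (ContinuousOn.intervalIntegrable_of_Icc h1 ?_)
        exact continuousOn_const.mul
          (continuousOn_id.inv₀ fun t ht => (hx.trans_le ht.1).ne')
      have hv : ∫ t in Set.Ioc x 1, x * t⁻¹ = -(x * Real.log x) := by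
        rw [← intervalIntegral.integral_of_le h1, intervalIntegral.integral_const_mul,
          integral_inv_of_pos hx one_pos, one_div, Real.log_inv, mul_neg]
      rw [← hv, MeasureTheory.ofReal_integral_eq_lintegral_ofReal
        ((intervalIntegrable_iff_integrableOn_Ioc_of_le h1).1 hi)]
      · refine MeasureTheory.setLIntegral_congr_fun measurableSet_Ioc fun t ht => ?_
        rw [min_eq_left ht.1.le, ← div_eq_mul_inv, ENNReal.ofReal_div_of_pos (hx.trans ht.1)]
      · refine MeasureTheory.ae_restrict_of_forall_mem measurableSet_Ioc fun t ht => ?_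
        exact mul_nonneg h0 (inv_nonneg.2 (hx.trans ht.1).le)
  rw [← Set.Ioc_union_Ioc_eq_Ioc h0 h1, MeasureTheory.lintegral_union measurableSet_Ioc
    (Set.Ioc_disjoint_Ioc_of_le le_rfl), ha, hb, add_comm]

/-- Balls of radius `1/2` around orthonormal vectors are disjoint, so Hilbert bases of separable
spaces are countable. -/
theorem countable_of_hilbertBasis {A : Type*} [NormedAddCommGroup A] [InnerProductSpace ℂ A]
    [TopologicalSpace.SeparableSpace A] {ι : Type*} (e : HilbertBasis ι ℂ A) : Countable ι := by
  refine Pairwise.countable_of_isOpen_disjoint (s := fun i => Metric.ball (e i) (1 / 2)) ?_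
    (fun i => Metric.isOpen_ball) fun i => ⟨e i, Metric.mem_ball_self (by norm_num)⟩
  intro i j hij
  refine Metric.ball_disjoint_ball ?_
  have h := norm_sub_sq (𝕜 := ℂ) (e i) (e j)
  rw [e.orthonormal.2 hij, e.orthonormal.1 i, e.orthonormal.1 j] at h
  norm_num at h
  rw [dist_eq_norm]
  nlinarith [norm_nonneg (e i - e j)]

variable {A : Type*} [NormedAddCommGroup A] [InnerProductSpace ℂ A] [CompleteSpace A]
variable {B : Type*} [NormedAddCommGroup B] [InnerProductSpace ℂ B] [CompleteSpace B]

theorem tsum_eigenvalue (v : HTensor A B) {ι : Type*} (e : HilbertBasis ι ℂ A) {l : ι → ℝ≥0}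
    (hl : ∀ i, partialTrace (TraceClass.pure v) (e i) = ((l i : ℝ) : ℂ) • e i) :
    ∑' i, (l i : ℝ≥0∞) = ‖v‖ₑ ^ 2 := by
  have h := tsum_eigenvalue_mul_enorm_sq v e hl (ContinuousLinearMap.id ℂ A)
  rw [opTensor_id] at h
  have h1 : ∀ i, ‖e i‖ₑ = 1 := fun i => by
    rw [← ofReal_norm, e.orthonormal.1 i, ENNReal.ofReal_one]
  simpa only [ContinuousLinearMap.id_apply, h1, one_pow, mul_one] using h

theorem truncTrace_eq_tsum (v : HTensor A B) {ι : Type*} (e : HilbertBasis ι ℂ A) {l : ι → ℝ≥0}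
    (hl : ∀ i, partialTrace (TraceClass.pure v) (e i) = ((l i : ℝ) : ℂ) • e i) {t : ℝ}
    (ht : 0 ≤ t) :
    truncTrace (partialTrace (TraceClass.pure v)) t =
      ∑' i, ENNReal.ofReal (min (l i : ℝ) t) :=
  posTrace_cfc (isPositive_partialTrace_pure v) e hl (by fun_prop) fun _ hx _ => le_min hx ht

theorem entropy_mul_log_two (v : HTensor A B) (hv : ‖v‖ = 1) {ι : Type*} (e : HilbertBasis ι ℂ A)
    {l : ι → ℝ≥0}
    (hl : ∀ i, partialTrace (TraceClass.pure v) (e i) = ((l i : ℝ) : ℂ) • e i) :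
    entropy (partialTrace (TraceClass.pure v)) * ENNReal.ofReal (Real.log 2) =
      ∑' i, ENNReal.ofReal (-((l i : ℝ) * Real.log (l i))) := by
  have hlog : 0 < Real.log 2 := Real.log_pos one_lt_two
  have hf : ∀ x : ℝ, -(x * Real.logb 2 x) = -(x * Real.log x) / Real.log 2 := fun x => by
    rw [Real.logb]
    ring
  have h := posTrace_cfc (isPositive_partialTrace_pure v) e hl
    (f := fun x : ℝ => -(x * Real.logb 2 x))
    (by
      simp only [hf]
      exact Real.continuous_mul_log.neg.div_const _)
    (fun x h0 h1 => by
      have h2 := h1.trans (norm_partialTrace_pure_le v)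
      rw [hv, one_pow] at h2
      rw [hf]
      exact div_nonneg (neg_nonneg.2 (mul_nonpos_of_nonneg_of_nonpos h0
        (Real.log_nonpos h0 h2))) hlog.le)
  rw [entropy, h, ← ENNReal.tsum_mul_right]
  refine tsum_congr fun i => ?_
  rw [← ENNReal.ofReal_mul' hlog.le, hf, div_mul_cancel₀ _ hlog.ne']

variable [TopologicalSpace.SeparableSpace A]

theorem aemeasurable_truncTrace (v : HTensor A B) :
    AEMeasurable (fun t => truncTrace (partialTrace (TraceClass.pure v)) t / ENNReal.ofReal t)
      (MeasureTheory.volume.restrict (Set.Ioc (0 : ℝ) 1)) := by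
  obtain ⟨ι, e, l, hl⟩ := exists_eigenbasis (isCompactOperator_partialTrace_pure v)
    (isPositive_partialTrace_pure v)
  have : Countable ι := countable_of_hilbertBasis e
  refine AEMeasurable.congr (f := fun t : ℝ =>
    (∑' i, ENNReal.ofReal (min (l i : ℝ) t)) / ENNReal.ofReal t)
    (by fun_prop) ?_
  refine MeasureTheory.ae_restrict_of_forall_mem measurableSet_Ioc fun t ht => ?_
  simp only [truncTrace_eq_tsum v e hl ht.1.le]

/-- The entropy of a reduced state, in nats and shifted by `1`, is the integral of the truncated
traces; this is `x - x log x = ∫₀¹ min(x, t) dt / t` summed over the eigenvalues. -/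
theorem entropy_mul_log_two_add_one (v : HTensor A B) (hv : ‖v‖ = 1) :
    entropy (partialTrace (TraceClass.pure v)) * ENNReal.ofReal (Real.log 2) + 1 =
      ∫⁻ t in Set.Ioc (0 : ℝ) 1,
        truncTrace (partialTrace (TraceClass.pure v)) t / ENNReal.ofReal t := by
  obtain ⟨ι, e, l, hl⟩ := exists_eigenbasis (isCompactOperator_partialTrace_pure v)
    (isPositive_partialTrace_pure v)
  have : Countable ι := countable_of_hilbertBasis e
  have hsum : ∑' i, (l i : ℝ≥0∞) = 1 := by
    rw [tsum_eigenvalue v e hl, ← ofReal_norm, hv, ENNReal.ofReal_one, one_pow]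
  have hl1 : ∀ i, (l i : ℝ) ≤ 1 := fun i => by
    have h := (ENNReal.le_tsum i).trans hsum.le
    exact_mod_cast h
  rw [MeasureTheory.setLIntegral_congr_fun
    (g := fun t => ∑' i, ENNReal.ofReal (min (l i : ℝ) t) / ENNReal.ofReal t) measurableSet_Ioc]
  · rw [MeasureTheory.lintegral_tsum (fun i => by fun_prop), entropy_mul_log_two v hv e hl]
    simp only [lintegral_min_div (NNReal.coe_nonneg _) (hl1 _)]
    rw [ENNReal.tsum_add]
    simp only [ENNReal.ofReal_coe_nnreal, hsum]
  · intro t ht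
    simp only [truncTrace_eq_tsum v e hl ht.1.le, div_eq_mul_inv, ENNReal.tsum_mul_right]

end Entropy

/-! ### The variational principle for truncated traces -/

section Variational

variable {A : Type*} [NormedAddCommGroup A] [InnerProductSpace ℂ A]

theorem enorm_sub_starProjection_sq_add (U : Submodule ℂ A) [U.HasOrthogonalProjection] (x : A) :
    ‖(ContinuousLinearMap.id ℂ A - U.starProjection) x‖ₑ ^ 2 + ‖U.starProjection x‖ₑ ^ 2 =
      ‖x‖ₑ ^ 2 := by
  have h := Submodule.norm_sq_eq_add_norm_sq_starProjection x U
  rw [Submodule.starProjection_orthogonal] at h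
  have h1 := congrArg ENNReal.ofReal h
  rw [ENNReal.ofReal_add (by positivity) (by positivity)] at h1
  simp only [ENNReal.ofReal_pow (norm_nonneg _), ofReal_norm] at h1
  rw [h1, add_comm]

variable [CompleteSpace A]
variable {B : Type*} [NormedAddCommGroup B] [InnerProductSpace ℂ B] [CompleteSpace B]

/-- The squared norms of the projections of the basis vectors onto `U` sum up to `dim U`. -/
theorem tsum_enorm_starProjection_sq {ι : Type*} (e : HilbertBasis ι ℂ A) (U : Submodule ℂ A)
    [FiniteDimensional ℂ U] :
    ∑' i, ‖U.starProjection (e i)‖ₑ ^ 2 = (Module.finrank ℂ U : ℝ≥0∞) := by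
  have h := tsum_enorm_sq_adjoint e (stdOrthonormalBasis ℂ U).toHilbertBasis
    U.orthogonalProjectionOnto
  have h1 : ∀ x, ‖U.starProjection x‖ₑ = ‖U.orthogonalProjectionOnto x‖ₑ := fun x => rfl
  have h2 : ∀ j, ‖ContinuousLinearMap.adjoint U.orthogonalProjectionOnto
      ((stdOrthonormalBasis ℂ U).toHilbertBasis j)‖ₑ = 1 := fun j => by
    rw [Submodule.adjoint_orthogonalProjectionOnto, ← ofReal_norm,
      Submodule.subtypeL_apply, ← Submodule.coe_norm,
      (stdOrthonormalBasis ℂ U).toHilbertBasis.orthonormal.1 j, ENNReal.ofReal_one]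
  simp only [h1, h, h2, one_pow, tsum_fintype, Finset.sum_const, Finset.card_univ,
    Fintype.card_fin, nsmul_eq_mul, mul_one]

/-- `Tr min(ρ, t) ≤ Tr (1 - P) ρ (1 - P) + t Tr P` for every projection `P` of finite rank. -/
theorem truncTrace_le (v : HTensor A B) {t : ℝ} (ht : 0 ≤ t) (U : Submodule ℂ A)
    [FiniteDimensional ℂ U] :
    truncTrace (partialTrace (TraceClass.pure v)) t ≤
      ‖opTensor (ContinuousLinearMap.id ℂ A - U.starProjection) (ContinuousLinearMap.id ℂ B) v‖ₑ ^ 2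
        + ENNReal.ofReal t * (Module.finrank ℂ U : ℝ≥0∞) := by
  obtain ⟨ι, e, l, hl⟩ := exists_eigenbasis (isCompactOperator_partialTrace_pure v)
    (isPositive_partialTrace_pure v)
  rw [truncTrace_eq_tsum v e hl ht, ← tsum_eigenvalue_mul_enorm_sq v e hl,
    ← tsum_enorm_starProjection_sq e U, ← ENNReal.tsum_mul_left, ← ENNReal.tsum_add]
  refine ENNReal.tsum_le_tsum fun i => ?_
  have h1 := enorm_sub_starProjection_sq_add U (e i)
  rw [← ofReal_norm (e i), e.orthonormal.1 i, ENNReal.ofReal_one, one_pow] at h1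
  -- The minimum is at most the convex combination of `l i` and `t` with the weights
  -- `‖(1 - P) (e i)‖²` and `‖P (e i)‖²`.
  calc ENNReal.ofReal (min (l i : ℝ) t)
      = ENNReal.ofReal (min (l i : ℝ) t) *
          ‖(ContinuousLinearMap.id ℂ A - U.starProjection) (e i)‖ₑ ^ 2 +
        ENNReal.ofReal (min (l i : ℝ) t) * ‖U.starProjection (e i)‖ₑ ^ 2 := by
        rw [← mul_add, h1, mul_one]
    _ ≤ _ := by
        gcongr
        · exact (ENNReal.ofReal_le_ofReal (min_le_left _ _)).trans ENNReal.ofReal_coe_nnreal.le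
        · exact min_le_right _ _

/-- The bound `truncTrace_le` is attained by the spectral projection onto the eigenvalues that
are at least `t`. -/
theorem exists_le_truncTrace (v : HTensor A B) {t : ℝ} (ht : 0 < t) :
    ∃ (U : Submodule ℂ A) (_ : FiniteDimensional ℂ U),
      ‖opTensor (ContinuousLinearMap.id ℂ A - U.starProjection) (ContinuousLinearMap.id ℂ B) v‖ₑ ^ 2
        + ENNReal.ofReal t * (Module.finrank ℂ U : ℝ≥0∞) ≤
      truncTrace (partialTrace (TraceClass.pure v)) t := by
  classical
  obtain ⟨ι, e, l, hl⟩ := exists_eigenbasis (isCompactOperator_partialTrace_pure v)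
    (isPositive_partialTrace_pure v)
  have hfin : {i | ENNReal.ofReal t ≤ l i}.Finite :=
    ENNReal.finite_const_le_of_tsum_ne_top (a := fun i => (l i : ℝ≥0∞))
      (by
        rw [tsum_eigenvalue v e hl]
        exact (ENNReal.pow_lt_top enorm_lt_top).ne)
      (ENNReal.ofReal_pos.2 ht).ne'
  -- Only finitely many eigenvalues are at least `t > 0` because their sum is finite.
  let J : Finset ι := hfin.toFinset
  have hJ : ∀ i, i ∈ J ↔ t ≤ l i := fun i => by
    rw [Set.Finite.mem_toFinset, Set.mem_ofPred_eq, ← ENNReal.ofReal_coe_nnreal,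
      ENNReal.ofReal_le_ofReal_iff (NNReal.coe_nonneg _)]
  let U : Submodule ℂ A := Submodule.span ℂ (J.image e : Set A)
  have hU : FiniteDimensional ℂ U := FiniteDimensional.span_finset ℂ _
  refine ⟨U, hU, ?_⟩
  have hdim : Module.finrank ℂ U ≤ J.card :=
    (finrank_span_finset_le_card _).trans Finset.card_image_le
  have hin : ∀ i ∈ J, U.starProjection (e i) = e i := fun i hi =>
    Submodule.starProjection_eq_self_iff.2
      (Submodule.subset_span (Finset.mem_coe.2 (Finset.mem_image_of_mem e hi)))
  have hout : ∀ i, ‖(ContinuousLinearMap.id ℂ A - U.starProjection) (e i)‖ₑ ^ 2 ≤ 1 := fun i => by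
    refine (self_le_add_right _ _).trans (enorm_sub_starProjection_sq_add U (e i)).le |>.trans ?_
    rw [← ofReal_norm (e i), e.orthonormal.1 i, ENNReal.ofReal_one, one_pow]
  have hcard : ENNReal.ofReal t * (Module.finrank ℂ U : ℝ≥0∞) ≤
      ∑' i, if i ∈ J then ENNReal.ofReal t else 0 := by
    rw [tsum_eq_sum (s := J) fun i hi => if_neg hi, Finset.sum_congr rfl fun i hi => if_pos hi,
      Finset.sum_const, nsmul_eq_mul, mul_comm]
    gcongr
  rw [truncTrace_eq_tsum v e hl ht.le, ← tsum_eigenvalue_mul_enorm_sq v e hl]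
  refine (add_le_add_right hcard _).trans ?_
  rw [← ENNReal.tsum_add]
  refine ENNReal.tsum_le_tsum fun i => ?_
  by_cases hi : i ∈ J
  · rw [if_pos hi, min_eq_right ((hJ i).1 hi), sub_apply, hin i hi]
    simp
  · rw [if_neg hi, add_zero, min_eq_left (not_le.1 fun h => hi ((hJ i).2 h)).le,
      ENNReal.ofReal_coe_nnreal]
    exact mul_le_of_le_one_right' (hout i)

end Variational

/-! ### Entropy under product Kraus operators -/

section ProductKraus

variable {A : Type*} [NormedAddCommGroup A] [InnerProductSpace ℂ A]
variable {B : Type*} [NormedAddCommGroup B] [InnerProductSpace ℂ B]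
variable {A' : Type*} [NormedAddCommGroup A'] [InnerProductSpace ℂ A']
variable {B' : Type*} [NormedAddCommGroup B'] [InnerProductSpace ℂ B']

/-- Let `P`, `P'` be the projections onto `U`, `U'`. If `L` maps `U` into `U'`, then
`(1 - P') L P = 0`, so the part of `(L ⊗ M) ψ` outside of `U'` comes from the part of
`ψ` outside of `U`. -/
theorem enorm_opTensor_compl_le (L : A →L[ℂ] A') (M : B →L[ℂ] B') (ψ : HTensor A B)
    (U : Submodule ℂ A) [U.HasOrthogonalProjection] (U' : Submodule ℂ A')
    [U'.HasOrthogonalProjection] (hU : ∀ x ∈ U, L x ∈ U') :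
    ‖opTensor (ContinuousLinearMap.id ℂ A' - U'.starProjection) (ContinuousLinearMap.id ℂ B')
        (opTensor L M ψ)‖ₑ ≤
      ‖opTensor L M (opTensor (ContinuousLinearMap.id ℂ A - U.starProjection)
        (ContinuousLinearMap.id ℂ B) ψ)‖ₑ := by
  have h1 : (ContinuousLinearMap.id ℂ A' - U'.starProjection) ∘L L =
      (ContinuousLinearMap.id ℂ A' - U'.starProjection) ∘L L ∘L
        (ContinuousLinearMap.id ℂ A - U.starProjection) := by
    ext x
    have h2 : U'.starProjection (L (U.starProjection x)) = L (U.starProjection x) :=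
      Submodule.starProjection_eq_self_iff.2 (hU _ (U.starProjection_apply_mem x))
    simp only [ContinuousLinearMap.comp_apply, sub_apply,
      ContinuousLinearMap.id_apply, map_sub, h2]
    abel
  have h3 : opTensor (ContinuousLinearMap.id ℂ A' - U'.starProjection)
        (ContinuousLinearMap.id ℂ B') ∘L opTensor L M =
      opTensor (ContinuousLinearMap.id ℂ A' - U'.starProjection) (ContinuousLinearMap.id ℂ B') ∘L
        opTensor L M ∘L opTensor (ContinuousLinearMap.id ℂ A - U.starProjection)
          (ContinuousLinearMap.id ℂ B) := by
    simp only [opTensor_comp]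
    rw [h1]
    rfl
  have h4 : ‖ContinuousLinearMap.id ℂ A' - U'.starProjection‖ ≤ 1 := by
    rw [← Submodule.starProjection_orthogonal]
    exact Submodule.starProjection_norm_le _
  have h5 := congrArg (fun f => f ψ) h3
  simp only [ContinuousLinearMap.comp_apply] at h5
  rw [h5, ← ofReal_norm, ← ofReal_norm]
  refine ENNReal.ofReal_le_ofReal ((norm_opTensor_apply_le _ _ _).trans ?_)
  refine mul_le_of_le_one_left (norm_nonneg _) ?_
  exact mul_le_one₀ h4 (norm_nonneg _) ContinuousLinearMap.norm_id_le

theorem enorm_smul_sq {H : Type*} [NormedAddCommGroup H] [InnerProductSpace ℂ H] (c : ℂ) (v : H) :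
    ‖c • v‖ₑ ^ 2 = ‖c‖ₑ ^ 2 * ‖v‖ₑ ^ 2 := by
  rw [enorm_smul, mul_pow]

variable {κ : Type*} {L : κ → A →L[ℂ] A'} {M : κ → B →L[ℂ] B'} {ψ : HTensor A B}
  {φ : κ → HTensor A' B'} {c : κ → ℂ}

/-- The weights of the output ensemble sum to `1`. -/
theorem tsum_enorm_coeff_sq (h : ∀ η, ∑' k, ‖opTensor (L k) (M k) η‖ₑ ^ 2 = ‖η‖ₑ ^ 2)
    (hψ : ‖ψ‖ = 1) (hφ : ∀ k, ‖φ k‖ = 1) (hc : ∀ k, opTensor (L k) (M k) ψ = c k • φ k) :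
    ∑' k, ‖c k‖ₑ ^ 2 = 1 := by
  have h1 := h ψ
  simp only [hc, enorm_smul_sq] at h1
  simpa only [← ofReal_norm, hφ, hψ, ENNReal.ofReal_one, one_pow, mul_one] using h1

variable [CompleteSpace A] [CompleteSpace B] [CompleteSpace A'] [CompleteSpace B']

/-- Truncated traces do not increase on average under product Kraus operators. If `P` is the
optimal projection for the input, then the projection onto the image of its range under `L k` has
no larger rank, and it leaves out no more than the image of what `P` leaves out. -/
theorem tsum_truncTrace_le (h : ∀ η, ∑' k, ‖opTensor (L k) (M k) η‖ₑ ^ 2 = ‖η‖ₑ ^ 2)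
    (hψ : ‖ψ‖ = 1) (hφ : ∀ k, ‖φ k‖ = 1) (hc : ∀ k, opTensor (L k) (M k) ψ = c k • φ k)
    {t : ℝ} (ht : 0 < t) :
    ∑' k, ‖c k‖ₑ ^ 2 * truncTrace (partialTrace (TraceClass.pure (φ k))) t ≤
      truncTrace (partialTrace (TraceClass.pure ψ)) t := by
  obtain ⟨U, hU, hle⟩ := exists_le_truncTrace ψ ht
  refine le_trans ?_ hle
  -- The term `t · dim U` is distributed over `k` with the weights `|c k|²`, which sum to `1`.
  rw [← h, ← one_mul (ENNReal.ofReal t * _), ← tsum_enorm_coeff_sq h hψ hφ hc,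
    ← ENNReal.tsum_mul_right, ← ENNReal.tsum_add]
  refine ENNReal.tsum_le_tsum fun k => ?_
  refine (mul_le_mul_right (truncTrace_le (φ k) ht.le (U.map (L k).toLinearMap)) _).trans ?_
  rw [mul_add, ← enorm_smul_sq, ← map_smul, ← hc k]
  gcongr
  · exact enorm_opTensor_compl_le (L k) (M k) ψ U _ fun x hx => Submodule.mem_map_of_mem hx
  · exact Submodule.finrank_map_le _ _

/-- The average entropy of the reduced output states of product Kraus operators is at most the
entropy of the reduced input state. -/
theorem tsum_entropy_le [TopologicalSpace.SeparableSpace A] [TopologicalSpace.SeparableSpace A']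
    [Countable κ] (h : ∀ η, ∑' k, ‖opTensor (L k) (M k) η‖ₑ ^ 2 = ‖η‖ₑ ^ 2)
    (hψ : ‖ψ‖ = 1) (hφ : ∀ k, ‖φ k‖ = 1) (hc : ∀ k, opTensor (L k) (M k) ψ = c k • φ k) :
    ∑' k, ‖c k‖ₑ ^ 2 * entropy (partialTrace (TraceClass.pure (φ k))) ≤
      entropy (partialTrace (TraceClass.pure ψ)) := by
  -- Passing to nats and adding `1` is reversible in `[0, ∞]` and turns entropies into integrals.
  have hlog : ENNReal.ofReal (Real.log 2) ≠ 0 :=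
    (ENNReal.ofReal_pos.2 (Real.log_pos one_lt_two)).ne'
  rw [← ENNReal.mul_le_mul_iff_left hlog ENNReal.ofReal_ne_top,
    ← ENNReal.add_le_add_iff_right ENNReal.one_ne_top, entropy_mul_log_two_add_one ψ hψ]
  calc (∑' k, ‖c k‖ₑ ^ 2 * entropy (partialTrace (TraceClass.pure (φ k)))) *
        ENNReal.ofReal (Real.log 2) + 1
      = ∑' k, ‖c k‖ₑ ^ 2 * (entropy (partialTrace (TraceClass.pure (φ k))) *
          ENNReal.ofReal (Real.log 2) + 1) := by
        simp only [mul_add, mul_one, ENNReal.tsum_add, tsum_enorm_coeff_sq h hψ hφ hc, ← mul_assoc,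
          ENNReal.tsum_mul_right]
    _ = ∫⁻ t in Set.Ioc (0 : ℝ) 1, ∑' k, ‖c k‖ₑ ^ 2 *
          (truncTrace (partialTrace (TraceClass.pure (φ k))) t / ENNReal.ofReal t) := by
        rw [MeasureTheory.lintegral_tsum fun k => (aemeasurable_truncTrace (φ k)).const_mul _]
        refine tsum_congr fun k => ?_
        rw [entropy_mul_log_two_add_one (φ k) (hφ k),
          MeasureTheory.lintegral_const_mul'' _ (aemeasurable_truncTrace (φ k))]
    _ ≤ _ := by
        refine MeasureTheory.setLIntegral_mono' measurableSet_Ioc fun t ht => ?_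
        simp only [div_eq_mul_inv, ← mul_assoc, ENNReal.tsum_mul_right]
        gcongr
        exact tsum_truncTrace_le h hψ hφ hc ht.1

end ProductKraus

/-! ### Separable instruments and channels -/

section Separable

variable {A : Type*} [NormedAddCommGroup A] [InnerProductSpace ℂ A]
variable {B : Type*} [NormedAddCommGroup B] [InnerProductSpace ℂ B]
variable {A' : Type*} [NormedAddCommGroup A'] [InnerProductSpace ℂ A']
variable {B' : Type*} [NormedAddCommGroup B'] [InnerProductSpace ℂ B']

/-- Trace preservation in terms of Kraus operators: `∑ₖ K k† K k = 1`, as a quadratic form. -/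
theorem tsum_enorm_kraus_sq {H G : Type*} [NormedAddCommGroup H] [InnerProductSpace ℂ H]
    [CompleteSpace H] [NormedAddCommGroup G] [InnerProductSpace ℂ G] [CompleteSpace G]
    {κ : Type*} {K : κ → H →L[ℂ] G} {E : TraceClass H →ₗ[ℂ] TraceClass G}
    (hE : IsTracePreserving E) (hK : ∀ T, HasSum (fun k => TraceClass.conj (K k) T) (E T)) (η : H) :
    ∑' k, ‖K k η‖ₑ ^ 2 = ‖η‖ₑ ^ 2 := by
  have h := hK (TraceClass.pure η)
  simp only [TraceClass.conj_pure] at h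
  rw [TraceClass.tsum_enorm_sq_of_hasSum_pure h ((hE _).trans (TraceClass.trace_pure η)),
    ENNReal.ofReal_pow (norm_nonneg _), ofReal_norm]

open Classical in
theorem inner_regVec {ι : Type*} (i j : ι) :
    ⟪regVec i, regVec j⟫_ℂ = if i = j then 1 else 0 := by
  rw [regVec, regVec, lp.inner_single_left, lp.single_apply, Pi.single_apply]
  split_ifs <;> simp

variable [CompleteSpace A']

open Classical in
/-- Reading the outcome `i` off the register. -/
theorem conj_adjoint_regVec_recordOutcome {ι : Type*} (i j : ι)
    (T : TraceClass (HTensor A' B')) :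
    TraceClass.conj (opTensor (ContinuousLinearMap.adjoint (tensorRight (regVec i)))
      (ContinuousLinearMap.id ℂ B')) (recordOutcome j T) = if i = j then T else 0 := by
  rw [recordOutcome, TraceClass.conj_conj, opTensor_comp, adjoint_tensorRight_comp_tensorRight,
    inner_regVec]
  apply TraceClass.toOp_injective
  split_ifs
  · rw [one_smul, ContinuousLinearMap.id_comp, opTensor_id, TraceClass.toOp_conj,
      ContinuousLinearMap.adjoint_id, ContinuousLinearMap.comp_id, ContinuousLinearMap.id_comp]
  · have h : opTensor (0 : A' →L[ℂ] A') (ContinuousLinearMap.id ℂ B') = 0 :=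
      HTensor.clm_ext fun a b => by simp [opTensor_tensorRight]
    rw [zero_smul, ContinuousLinearMap.id_comp, h, TraceClass.toOp_conj,
      ContinuousLinearMap.zero_comp, map_zero]

/-- The elements of a countably separable instrument have product Kraus operators. -/
theorem IsCountablySeparableInstrument.exists_kraus {ι : Type*}
    {E : ι → TraceClass (HTensor A B) →ₗ[ℂ] TraceClass (HTensor A' B')}
    (hE : IsCountablySeparableInstrument E) :
    ∃ (L : ι → ℕ → A →L[ℂ] A') (M : ℕ → B →L[ℂ] B'), ∀ i T,
      HasSum (fun k => TraceClass.conj (opTensor (L i k) (M k)) T) (E i T) := by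
  classical
  obtain ⟨-, F, hF, -, L, M, hLM⟩ := hE
  refine ⟨fun i k => ContinuousLinearMap.adjoint (tensorRight (regVec i)) ∘L L k, M,
    fun i T => ?_⟩
  have h1 := (hLM T).mapL (TraceClass.conjCLM (opTensor
    (ContinuousLinearMap.adjoint (tensorRight (regVec i))) (ContinuousLinearMap.id ℂ B')))
  have h2 := (hF T).mapL (TraceClass.conjCLM (opTensor
    (ContinuousLinearMap.adjoint (tensorRight (regVec i))) (ContinuousLinearMap.id ℂ B')))
  simp only [TraceClass.conjCLM_apply, conj_adjoint_regVec_recordOutcome] at h1 h2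
  have h3 := h2.unique (hasSum_single i fun j hj => if_neg (Ne.symm hj))
  rw [if_pos rfl] at h3
  rw [h3] at h1
  simpa only [TraceClass.conj_conj, opTensor_comp, ContinuousLinearMap.id_comp] using h1

variable [CompleteSpace A] [CompleteSpace B] [CompleteSpace B']

/-- The entropy of entanglement of a pure state does not increase on average under a countably
separable instrument with pure outcomes. -/
theorem IsCountablySeparableInstrument.tsum_entropy_le [TopologicalSpace.SeparableSpace A]
    [TopologicalSpace.SeparableSpace A'] {ι : Type*} [Countable ι]
    {E : ι → TraceClass (HTensor A B) →ₗ[ℂ] TraceClass (HTensor A' B')}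
    (hE : IsCountablySeparableInstrument E) {ψ : HTensor A B} (hψ : ‖ψ‖ = 1) {p : ι → ℝ≥0}
    {φ : ι → HTensor A' B'} (hφ : ∀ x, ‖φ x‖ = 1)
    (hEψ : ∀ x, E x (TraceClass.pure ψ) = ((p x : ℝ) : ℂ) • TraceClass.pure (φ x)) :
    ∑' x, (p x : ℝ≥0∞) * entropy (partialTrace (TraceClass.pure (φ x))) ≤
      entropy (partialTrace (TraceClass.pure ψ)) := by
  obtain ⟨L, M, hLM⟩ := hE.exists_kraus
  have hsum : ∀ η : HTensor A B, ∑' y : ι × ℕ, ‖opTensor (L y.1 y.2) (M y.2) η‖ₑ ^ 2 =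
      ‖η‖ₑ ^ 2 := by
    intro η
    -- The sum of the instrument preserves the trace of `|η⟩⟨η|`.
    obtain ⟨-, F, hF, hEF⟩ := hE.1
    have h1 := (hEF (TraceClass.pure η)).mapL (TraceClass.traceCLM _)
    simp only [TraceClass.traceCLM_apply, hF.2 (TraceClass.pure η), TraceClass.trace_pure] at h1
    have h2 : ∀ x, HasSum (fun k => TraceClass.pure (opTensor (L x k) (M k) η))
        (E x (TraceClass.pure η)) := fun x => by
      simpa only [TraceClass.conj_pure] using hLM x (TraceClass.pure η)
    have h3 : ∀ x, HasSum (fun k => ((‖opTensor (L x k) (M k) η‖ ^ 2 : ℝ) : ℂ))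
        (E x (TraceClass.pure η)).trace := fun x => by
      simpa only [TraceClass.traceCLM_apply, TraceClass.trace_pure] using
        (h2 x).mapL (TraceClass.traceCLM _)
    have h4 : ∀ x, HasSum (fun k => ‖opTensor (L x k) (M k) η‖ ^ 2)
        (E x (TraceClass.pure η)).trace.re := fun x => Complex.hasSum_re (h3 x)
    have h5 : HasSum (fun x => (E x (TraceClass.pure η)).trace.re) (‖η‖ ^ 2) :=
      Complex.hasSum_re h1
    rw [ENNReal.tsum_prod (f := fun x k => ‖opTensor (L x k) (M k) η‖ₑ ^ 2)]
    simp only [fun x => TraceClass.tsum_enorm_sq_of_hasSum_pure (h2 x)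
      ((h3 x).unique (Complex.hasSum_ofReal.2 (h4 x)))]
    rw [← ENNReal.ofReal_tsum_of_nonneg (fun x => (h4 x).nonneg fun k => sq_nonneg _)
      h5.summable, h5.tsum_eq, ENNReal.ofReal_pow (norm_nonneg _), ofReal_norm]
  have hpure : ∀ x, HasSum (fun k => TraceClass.pure (opTensor (L x k) (M k) ψ))
      (((p x : ℝ) : ℂ) • TraceClass.pure (φ x)) := fun x => by
    simpa only [TraceClass.conj_pure, hEψ] using hLM x (TraceClass.pure ψ)
  choose c hc using fun x => TraceClass.exists_smul_of_hasSum_pure (hφ x) (hpure x)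
  have hp : ∀ x, ∑' k, ‖c x k‖ₑ ^ 2 = p x := fun x => by
    have h := TraceClass.tsum_enorm_sq_of_hasSum_pure (r := p x) (hpure x) (by
      rw [← TraceClass.traceCLM_apply, map_smul, TraceClass.traceCLM_apply, TraceClass.trace_pure,
        hφ]
      simp)
    simpa only [hc, enorm_smul_sq, ← ofReal_norm (φ x), hφ, ENNReal.ofReal_one, one_pow, mul_one,
      ENNReal.ofReal_coe_nnreal] using h
  have h := EntForm.tsum_entropy_le (κ := ι × ℕ) (φ := fun y => φ y.1) (c := fun y => c y.1 y.2)
    hsum hψ (fun y => hφ y.1) fun y => hc y.1 y.2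
  rw [ENNReal.tsum_prod (f := fun x k => ‖c x k‖ₑ ^ 2 *
    entropy (partialTrace (TraceClass.pure (φ x))))] at h
  simpa only [ENNReal.tsum_mul_right, hp] using h

/-- An absolutely convergent double series may be summed in one step; completeness is not needed
because the sum is known to exist. -/
theorem hasSum_prod_of_hasSum_hasSum {V : Type*} [NormedAddCommGroup V] {ι κ : Type*}
    {f : κ × ι → V} {g : κ → V} {s : V} (hf : Summable fun x => ‖f x‖)
    (hg : ∀ k, HasSum (fun i => f (k, i)) (g k)) (hs : HasSum g s) : HasSum f s := by
  have h1 : Summable (UniformSpace.Completion.toCompl ∘ f) :=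
    Summable.of_norm (hf.congr fun x => (UniformSpace.Completion.norm_coe (f x)).symm)
  have h2 : HasSum (UniformSpace.Completion.toCompl ∘ g) _ :=
    h1.hasSum.prod_fiberwise fun k =>
      (hasSum_iff_hasSum_compl (fun i => f (k, i)) (g k)).2 (hg k)
  refine (hasSum_iff_hasSum_compl f s).1 ?_
  rw [← h2.unique ((hasSum_iff_hasSum_compl g s).2 hs)]
  exact h1.hasSum

/-- Every vector is a multiple of a unit vector; `u` serves for the zero vector. -/
theorem exists_smul_unit {H : Type*} [NormedAddCommGroup H] [InnerProductSpace ℂ H] {u : H}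
    (hu : ‖u‖ = 1) (v : H) : ∃ (c : ℂ) (φ : H), ‖φ‖ = 1 ∧ v = c • φ := by
  rcases eq_or_ne v 0 with rfl | hv
  · exact ⟨0, u, hu, (zero_smul ℂ u).symm⟩
  · refine ⟨‖v‖, (‖v‖ : ℂ)⁻¹ • v, norm_smul_inv_norm hv, ?_⟩
    rw [smul_inv_smul₀ (Complex.ofReal_ne_zero.2 (norm_ne_zero_iff.2 hv))]

/-- A decomposition over any countably infinite index type bounds the entanglement of formation. -/
theorem entanglementOfFormation_le_tsum {κ : Type*} (e : ℕ ≃ κ) {ρ : TraceClass (HTensor A B)}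
    {p : κ → ℝ≥0} {ψ : κ → HTensor A B} (hp : HasSum p 1) (hψ : ∀ y, ‖ψ y‖ = 1)
    (hρ : HasSum (fun y => ((p y : ℝ) : ℂ) • TraceClass.pure (ψ y)) ρ) :
    entanglementOfFormation ρ ≤
      ∑' y, (p y : ℝ≥0∞) * entropy (partialTrace (TraceClass.pure (ψ y))) := by
  rw [← e.tsum_eq fun y => (p y : ℝ≥0∞) * entropy (partialTrace (TraceClass.pure (ψ y)))]
  unfold entanglementOfFormation
  refine (iInf_le _ (p ∘ e)).trans ?_
  refine (iInf_le _ (ψ ∘ e)).trans ?_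
  refine (iInf_le _ (e.hasSum_iff.2 hp)).trans ?_
  refine (iInf_le _ fun n => hψ (e n)).trans ?_
  exact iInf_le _ (e.hasSum_iff.2 hρ)

/-- The entanglement of formation does not increase under countably separable channels. -/
theorem IsCountablySeparable.entanglementOfFormation_le [TopologicalSpace.SeparableSpace A]
    [TopologicalSpace.SeparableSpace A']
    {E : TraceClass (HTensor A B) →ₗ[ℂ] TraceClass (HTensor A' B')}
    (hE : IsCountablySeparable E) (ρ : TraceClass (HTensor A B)) :
    entanglementOfFormation (E ρ) ≤ entanglementOfFormation ρ := by
  obtain ⟨⟨-, hTP⟩, L, M, hLM⟩ := hE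
  have hsum := fun η => tsum_enorm_kraus_sq hTP hLM η
  refine le_iInf fun p => le_iInf fun ψ => le_iInf fun hp => le_iInf fun hψ => le_iInf fun hρ => ?_
  -- The output space is nonzero because some Kraus operator does not annihilate `ψ 0`.
  obtain ⟨u, hu⟩ : ∃ u : HTensor A' B', ‖u‖ = 1 := by
    have h1 : ∑' k, ‖opTensor (L k) (M k) (ψ 0)‖ₑ ^ 2 ≠ 0 := by
      rw [hsum, ← ofReal_norm, hψ]
      simp
    obtain ⟨k, hk⟩ := not_forall.1 (mt ENNReal.tsum_eq_zero.2 h1)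
    exact ⟨_, norm_smul_inv_norm (𝕜 := ℂ) (x := opTensor (L k) (M k) (ψ 0))
      fun h0 => hk (by simp [h0])⟩
  choose c φ hφ hc using fun y : ℕ × ℕ =>
    exists_smul_unit hu (opTensor (L y.1) (M y.1) (ψ y.2))
  let q : ℕ × ℕ → ℝ≥0 := fun y => p y.2 * ‖c y‖₊ ^ 2
  have hqe : ∀ y, (q y : ℝ≥0∞) = p y.2 * ‖c y‖ₑ ^ 2 := fun y => by
    rw [ENNReal.coe_mul, ENNReal.coe_pow, enorm_eq_nnnorm]
  have hq : HasSum q 1 := by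
    rw [← ENNReal.hasSum_coe]
    have h1 : ∑' y, (q y : ℝ≥0∞) = ((1 : ℝ≥0) : ℝ≥0∞) := by
      simp only [hqe]
      rw [ENNReal.tsum_prod (f := fun k x => (p x : ℝ≥0∞) * ‖c (k, x)‖ₑ ^ 2), ENNReal.tsum_comm]
      simp only [ENNReal.tsum_mul_left]
      simp only [fun x => tsum_enorm_coeff_sq hsum (hψ x) (fun k => hφ (k, x))
        fun k => hc (k, x), mul_one]
      exact (ENNReal.hasSum_coe.2 hp).tsum_eq
    rw [← h1]
    exact ENNReal.summable.hasSum
  have hterm : ∀ y, ((q y : ℝ) : ℂ) • TraceClass.pure (φ y) =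
      TraceClass.conj (opTensor (L y.1) (M y.1))
        (((p y.2 : ℝ) : ℂ) • TraceClass.pure (ψ y.2)) := fun y => by
    rw [map_smul, TraceClass.conj_pure, hc, TraceClass.pure_smul, smul_smul]
    congr 1
    push_cast [q]
    rfl
  have hdec : HasSum (fun y => ((q y : ℝ) : ℂ) • TraceClass.pure (φ y)) (E ρ) := by
    refine hasSum_prod_of_hasSum_hasSum
      (g := fun k => TraceClass.conj (opTensor (L k) (M k)) ρ) ?_ (fun k => ?_) (hLM ρ)
    · have h1 : ∀ y, ‖((q y : ℝ) : ℂ) • TraceClass.pure (φ y)‖ = q y := fun y => by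
        rw [norm_smul, TraceClass.norm_pure, hφ, one_pow, mul_one, Complex.norm_real,
          Real.norm_of_nonneg (NNReal.coe_nonneg _)]
      simp only [h1]
      exact NNReal.summable_coe.2 hq.summable
    · simp only [hterm]
      exact hρ.mapL (TraceClass.conjCLM (opTensor (L k) (M k)))
  refine (entanglementOfFormation_le_tsum Nat.pairEquiv.symm hq hφ hdec).trans ?_
  simp only [hqe, mul_assoc]
  rw [ENNReal.tsum_prod (f := fun k x => (p x : ℝ≥0∞) * (‖c (k, x)‖ₑ ^ 2 *
    entropy (partialTrace (TraceClass.pure (φ (k, x)))))), ENNReal.tsum_comm]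
  refine ENNReal.tsum_le_tsum fun x => ?_
  rw [ENNReal.tsum_mul_left]
  gcongr
  exact tsum_entropy_le hsum (hψ x) (fun k => hφ (k, x)) fun k => hc (k, x)

end Separable

end EntForm

theorem mainTheorem4
    {A : Type*} [NormedAddCommGroup A] [InnerProductSpace ℂ A] [CompleteSpace A]
    [TopologicalSpace.SeparableSpace A]
    {B : Type*} [NormedAddCommGroup B] [InnerProductSpace ℂ B] [CompleteSpace B]
    [TopologicalSpace.SeparableSpace B]
    {A' : Type*} [NormedAddCommGroup A'] [InnerProductSpace ℂ A'] [CompleteSpace A']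
    [TopologicalSpace.SeparableSpace A']
    {B' : Type*} [NormedAddCommGroup B'] [InnerProductSpace ℂ B'] [CompleteSpace B']
    [TopologicalSpace.SeparableSpace B'] :
    (∀ (ι : Type*) [Countable ι]
        (E : ι → EntForm.TraceClass (EntForm.HTensor A B) →ₗ[ℂ]
          EntForm.TraceClass (EntForm.HTensor A' B')),
        EntForm.IsCountablySeparableInstrument E →
        ∀ (ψ : EntForm.HTensor A B), ‖ψ‖ = 1 →
        ∀ (p : ι → ℝ≥0) (φ : ι → EntForm.HTensor A' B'), HasSum p 1 → (∀ x, ‖φ x‖ = 1) →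
        (∀ x, E x (EntForm.TraceClass.pure ψ) =
          ((p x : ℝ) : ℂ) • EntForm.TraceClass.pure (φ x)) →
        ∑' x, (p x : ℝ≥0∞) *
            EntForm.entropy (EntForm.partialTrace (EntForm.TraceClass.pure (φ x))) ≤
          EntForm.entropy (EntForm.partialTrace (EntForm.TraceClass.pure ψ))) ∧
    (∀ (E : EntForm.TraceClass (EntForm.HTensor A B) →ₗ[ℂ]
          EntForm.TraceClass (EntForm.HTensor A' B')),
        EntForm.IsCountablySeparable E →
        ∀ ρ : EntForm.TraceClass (EntForm.HTensor A B), ρ.IsDensity →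
          EntForm.entanglementOfFormation (E ρ) ≤ EntForm.entanglementOfFormation ρ) := by
  refine ⟨fun ι _ E hE ψ hψ p φ _ hφ hEψ => ?_, fun E hE ρ _ => ?_⟩
  · exact EntForm.IsCountablySeparableInstrument.tsum_entropy_le hE hψ hφ hEψ
  · exact EntForm.IsCountablySeparable.entanglementOfFormation_le hE ρ
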